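/- **Model.** Let $2\le k\le n$ and $p_a\in[0,1]$, with $p_a=1$ if $k=n$. In an $(n,k)$ sampling mix, $n$ senders send messages according to independent Poisson processes of a common rate $\lambda>0$, and the messages of each sender wait in a separate FIFO queue. Sender $i$ has a finite set $R_i$ of receivers; these sets are pairwise disjoint. Each message of sender $i$ is addressed, independently of everything else, to a receiver $r\in R_i$ drawn with a fixed probability $\pi_i(r)>0$, $\sum_{r\in R_i}\pi_i(r)=1$. When a message arrives it joins the queue of its sender. Then, independently of the past, with probability $p_a$ this queue and $k-1$ of the $n-1$ other queues, chosen uniformly at random, are released, and with probability $1-p_a$ only $k$ of the $n-1$ other queues, chosen uniformly at random, are released. Each released non-empty queue forwards its head-of-the-line message. The mix starts with arbitrary (possibly random) finite queue contents that are independent of all later arrivals, addresses and releases, the messages in queue $i$ being addressed to receivers in $R_i$. Upon each arrival the adversary records the sender of the arriving message and the set of recipients of the messages that depart. An intersection attack without state knowledge is a rule that computes, from the target sender and the unordered collection (multiset) of the records made so far, a set of receivers. The rule may depend on $n$, $k$, $p_a$ and the finite population of potential receivers, but not on the sets $R_i$, the probabilities $\pi_i$, the rate $\lambda$ or the queue contents.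 **Theorem 5.** Suppose that $p_a\neq 1/n$, and put $q=(1-p_a)/(n-1)$. Then $p_a\ne q$, and: 1. There is an intersection attack without state knowledge which identifies all receivers of any target: for every such mix and every target sender $a$, almost surely, the output of the attack after $T$ arrivals equals $R_a$ for all sufficiently large $T$. 2. For every target $a$, almost surely, for every sender $j$ and every $r\in R_j$, the number of departures to $r$ upon arrivals from $a$, divided by the number of arrivals from $a$, converges to $p_a\,\pi_a(r)$ if $j=a$ and to $q\,\pi_j(r)$ if $j\ne a$, as the number of recorded arrivals tends to infinity. 3. If the mix is in steady state (the joint law of the queue contents seen just before the $t$-th arrival does not depend on $t$), then, given that an arriving message is from sender $a$, the probability that a message departs from queue $j$ upon this arrival is $p_a$ if $j=a$, and $q$ if $j\neq a$. 4. If every sender has exactly one receiver, then almost surely, after all sufficiently many arrivals, the number of departures recorded upon arrivals from the target $a$ is strictly greater for the receiver of $a$ than for the receiver of any other sender if $p_a>1/n$, and strictly smaller if $p_a<1/n$. -/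

import Mathlib

open MeasureTheory ProbabilityTheory Filter Topology

/-- One realisation of everything that is random in a mix with `n` senders and receiver population
`R`. The `l`-th message of sender `i` comes `gap i l` time units after the previous message of `i`
(or after time `0`, if `l = 0`), is addressed to `dest i l`, and when it arrives the queues in
`release i l` are released. `init i` is the content of the queue of sender `i` at time `0`, head of
the line first; a buffered message is represented by its recipient. -/
structure MixInput (n : ℕ) (R : Type*) where
  gap : Fin n → ℕ → ℝ
  dest : Fin n → ℕ → R
  release : Fin n → ℕ → Finset (Fin n)
  init : Fin n → List R

namespace MixInput

/-- The index of the smallest of `n` numbers (the first such index if there are several). -/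
noncomputable def earliest {n : ℕ} [NeZero n] (c : Fin n → ℝ) : Fin n :=
  (Finset.univ.filter fun i => ∀ j, c i ≤ c j).min' (by
    obtain ⟨i, hi⟩ := Finite.exists_min c
    exact ⟨i, by simpa using hi⟩)

variable {n : ℕ} {R : Type*}

/-- The time at which the `l`-th message of sender `i` arrives to the mix. -/
noncomputable def arrivalTime (x : MixInput n R) (i : Fin n) (l : ℕ) : ℝ :=
  ∑ m ∈ Finset.range (l + 1), x.gap i m

variable [NeZero n]

/-- `x.sent t i` is the number of messages of sender `i` among the first `t` messages that arrive
to the mix, in the order of their arrival times. -/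
noncomputable def sent (x : MixInput n R) : ℕ → Fin n → ℕ
  | 0 => fun _ => 0
  | t + 1 =>
    let s := earliest fun i => x.arrivalTime i (x.sent t i)
    Function.update (x.sent t) s (x.sent t s + 1)

/-- The sender of the `t`-th message that arrives to the mix (counted from `0`). -/
noncomputable def sender (x : MixInput n R) (t : ℕ) : Fin n :=
  earliest fun i => x.arrivalTime i (x.sent t i)

/-- The set of queues released by the `t`-th arrival. -/
noncomputable def released (x : MixInput n R) (t : ℕ) : Finset (Fin n) :=
  x.release (x.sender t) (x.sent t (x.sender t))

/-- Append the `t`-th arriving message at the end of the queue of its sender. -/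
noncomputable def enqueue (x : MixInput n R) (t : ℕ) (b : Fin n → List R) : Fin n → List R :=
  Function.update b (x.sender t)
    (b (x.sender t) ++ [x.dest (x.sender t) (x.sent t (x.sender t))])

/-- The contents of the queues just before the `t`-th arrival: an arriving message joins its queue,
then every released queue forwards its head-of-the-line message, if it has one. -/
noncomputable def buffer (x : MixInput n R) : ℕ → Fin n → List R
  | 0 => x.init
  | t + 1 => fun j =>
    if j ∈ x.released t then (x.enqueue t (x.buffer t) j).tail else x.enqueue t (x.buffer t) j

/-- Queue `j` forwards the message `r` (a message to `r`) upon the `t`-th arrival. -/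
def Forwards (x : MixInput n R) (t : ℕ) (j : Fin n) (r : R) : Prop :=
  j ∈ x.released t ∧ (x.enqueue t (x.buffer t) j).head? = some r

open Classical in
/-- What the adversary sees upon the `t`-th arrival: the sender of the arriving message, and the
set of recipients of the messages that leave the mix. -/
noncomputable def round [Fintype R] (x : MixInput n R) (t : ℕ) : Fin n × Finset R :=
  (x.sender t, Finset.univ.filter fun r => ∃ j, x.Forwards t j r)

/-- The collection of the rounds seen by the adversary upon the first `T` arrivals. -/
noncomputable def record [Fintype R] (x : MixInput n R) (T : ℕ) : Multiset (Fin n × Finset R) :=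
  (Multiset.range T).map x.round

end MixInput

open Classical in
/-- The number of recorded arrivals from sender `a`. -/
noncomputable def arrivals {n : ℕ} {R : Type*} (M : Multiset (Fin n × Finset R)) (a : Fin n) : ℕ :=
  M.countP fun o => o.1 = a

open Classical in
/-- The number of recorded arrivals from sender `a` upon which a message departed to `r`. -/
noncomputable def departures {n : ℕ} {R : Type*} (M : Multiset (Fin n × Finset R)) (a : Fin n)
    (r : R) : ℕ :=
  M.countP fun o => o.1 = a ∧ r ∈ o.2

/-- An intersection attack without knowledge of the state of the mix: from the target sender and
the collection of recorded rounds (senders of arrivals, each with the set of recipients served upon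
it) it computes a guess for the set of receivers of the target. It sees neither the contents of the
queues, nor which queues are released, nor the order of the rounds, by which it might track the
queues. -/
abbrev StatelessAttack (n : ℕ) (R : Type*) :=
  Fin n → Multiset (Fin n × Finset R) → Finset R

/-- The probability that an arrival to queue `s` releases exactly the queues in `A`: with
probability `p` queue `s` together with `k - 1` uniformly random ones of the other `n - 1` queues,
with probability `1 - p` only `k` uniformly random ones of the other `n - 1` queues. -/
noncomputable def releaseProb (n k : ℕ) (p : ℝ) (s : Fin n) (A : Finset (Fin n)) : ℝ :=
  if A.card = k then
    if s ∈ A then p / ((n - 1).choose (k - 1) : ℝ) else (1 - p) / ((n - 1).choose k : ℝ)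
  else 0

/-- Labels of the primitive random variables of a mix. -/
inductive MixSource (n : ℕ)
  | gap (i : Fin n) (l : ℕ)
  | dest (i : Fin n) (l : ℕ)
  | release (i : Fin n) (l : ℕ)
  | init

/-- The σ-algebra generated by a primitive random variable of a random input. The spaces of
recipients, of sets of queues and of queue contents are countable and carry the discrete
σ-algebra. -/
@[reducible]
def MixSource.sigma {n : ℕ} {R Ω : Type*} (input : Ω → MixInput n R) :
    MixSource n → MeasurableSpace Ω
  | gap i l => MeasurableSpace.comap (fun ω => (input ω).gap i l) inferInstance
  | dest i l => MeasurableSpace.comap (fun ω => (input ω).dest i l) ⊤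
  | release i l => MeasurableSpace.comap (fun ω => (input ω).release i l) ⊤
  | init => MeasurableSpace.comap (fun ω => (input ω).init) ⊤

/-- An `(n, k)` sampling mix with parameter `p` on a probability space. Sender `i` sends messages
at the points of a Poisson process of rate `rate` (independent exponential interarrival times), and
addresses each message, independently, to a receiver drawn from a fixed distribution `choice i` on
its set of receivers `recv i`, where every receiver has positive probability. The receiver sets of
different senders are disjoint. Release sets have the law of the sampling mix. The initial contents
of the queues are random, with messages only to receivers of the respective sender. -/
structure SamplingMix (n k : ℕ) (p : ℝ) (R : Type*) {Ω : Type*} [MeasurableSpace Ω]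
    (μ : Measure Ω) where
  rate : ℝ
  rate_pos : 0 < rate
  recv : Fin n → Finset R
  recv_disjoint : ∀ i j, i ≠ j → Disjoint (recv i) (recv j)
  choice : Fin n → PMF R
  support_choice : ∀ i, (choice i).support = (recv i : Set R)
  input : Ω → MixInput n R
  sigma_le : ∀ v : MixSource n, v.sigma input ≤ ‹MeasurableSpace Ω›
  indep : iIndep (fun v : MixSource n => v.sigma input) μ
  law_gap : ∀ i l, μ.map (fun ω => (input ω).gap i l) = expMeasure rate
  law_dest : ∀ i l r, μ {ω | (input ω).dest i l = r} = choice i r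
  law_release : ∀ i l A,
    μ {ω | (input ω).release i l = A} = ENNReal.ofReal (releaseProb n k p i A)
  init_mem : ∀ ω i, ∀ r ∈ (input ω).init i, r ∈ recv i

/-- The mix is in steady state: the joint law of the contents of the queues does not change. -/
def SamplingMix.InSteadyState {n k : ℕ} [NeZero n] {p : ℝ} {R Ω : Type*} [MeasurableSpace Ω]
    {μ : Measure Ω} (X : SamplingMix n k p R μ) : Prop :=
  ∀ (t : ℕ) (b : Fin n → List R),
    μ {ω | (X.input ω).buffer t = b} = μ {ω | (X.input ω).buffer 0 = b}

/-! Write `q = (1 - p) / (n - 1)`. For a receiver `r` of sender `j`, the share of departures to `r`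
among the arrivals from `b` tends to `π_j(r) p` if `b = j` and to `π_j(r) q` otherwise. Since `p >
q` exactly when `p > 1/n`, and `p < q` exactly when `p < 1/n`, comparing these shares for one fixed
`r` over different `b` cancels the unknown factor `π_j(r)` and reveals the owner of `r`. This is
`frequencyAttack`.

The limits follow from conservation of messages and need neither ergodicity nor a stationary law of
the queues. By memorylessness, the steps (sender, release set) are i.i.d. and independent of the
initial contents (`measure_pathEvent`). The length of queue `j` is a walk reflected at zero with
drift `(1 - k)/n < 0`, hence sublinear, so messages leave at the rate `1/n` at which they enter
(`ae_hasAverage_departs`). Arrivals from `j` itself account for the rate `p/n`, because the arriving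
message makes the queue non-empty. The remaining `(1 - p)/n` is due to arrivals from others, which
release `j` at rate `(k - p)/n` independently of the past. So `j` is non-empty for a fraction `(1 -
p)/(k - p)` of the arrivals (`ae_hasAverage_buffer_ne_nil`). An arrival from a fixed `a ≠ j`
releases `j` with probability `(k - p)/(n - 1)`, and the product of the two is `q`.

When messages depart is decided by the steps and the initial queue lengths, not by the addresses.
Hence the addresses of departing messages average out to `π_j` (`ae_hasAverage_departsAs`), up to
the finitely many initial messages. Each passage from events to probabilities is a law of large
numbers for bounded orthogonal variables (`ae_tendsto_average_of_orthogonal`). In steady state the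
probability that a queue is non-empty is constant in time, hence equal to the long-run fraction. -/

/-! ### A strong law of large numbers for bounded orthogonal variables. -/

/-- Partial averages of a bounded sequence converge to zero as soon as they do so along the
squares. -/
theorem tendsto_average_of_tendsto_average_sq {w : ℕ → ℝ} {C : ℝ} (hC : ∀ t, |w t| ≤ C)
    (h : Tendsto (fun m : ℕ => (∑ t ∈ Finset.range (m ^ 2), w t) / (m : ℝ) ^ 2) atTop (𝓝 0)) :
    Tendsto (fun T : ℕ => (∑ t ∈ Finset.range T, w t) / (T : ℝ)) atTop (𝓝 0) := by
  have hC0 : 0 ≤ C := (abs_nonneg _).trans (hC 0)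
  have hsq : Tendsto Nat.sqrt atTop atTop := by
    refine tendsto_atTop_atTop.2 fun b => ⟨b ^ 2, fun a ha => ?_⟩
    rw [Nat.le_sqrt']
    exact ha
  have h1 := (h.comp hsq).abs
  have h2 : Tendsto (fun T : ℕ => 2 * C * ((Nat.sqrt T : ℝ))⁻¹) atTop (𝓝 0) := by
    simpa using ((tendsto_inv_atTop_zero.comp
      (tendsto_natCast_atTop_atTop (R := ℝ))).comp hsq).const_mul (2 * C)
  have h3 := h1.add h2
  rw [abs_zero, add_zero] at h3
  refine squeeze_zero_norm' ?_ h3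
  filter_upwards [eventually_ge_atTop 1] with T hT
  -- Between the square `m ^ 2` below `T` and `T` itself there are at most `2 * m` terms, which is
  -- negligible against `m ^ 2`.
  set m := Nat.sqrt T with hm
  have hm1 : 1 ≤ m := by rw [hm, Nat.le_sqrt']; simpa using hT
  have hmT : m ^ 2 ≤ T := Nat.sqrt_le' T
  have hTm : T < (m + 1) ^ 2 := Nat.lt_succ_sqrt' T
  have hm0 : (0 : ℝ) < m := by exact_mod_cast hm1
  have hT0 : (0 : ℝ) < T := by exact_mod_cast hT
  have hmT' : (m : ℝ) ^ 2 ≤ T := by exact_mod_cast hmT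
  have hsplit : ∑ t ∈ Finset.range T, w t
      = ∑ t ∈ Finset.range (m ^ 2), w t + ∑ t ∈ Finset.Ico (m ^ 2) T, w t :=
    (Finset.sum_range_add_sum_Ico _ hmT).symm
  have hrest : |∑ t ∈ Finset.Ico (m ^ 2) T, w t| ≤ 2 * m * C := by
    refine (Finset.abs_sum_le_sum_abs _ _).trans ((Finset.sum_le_card_nsmul _ _ C
      fun t _ => hC t).trans ?_)
    rw [Nat.card_Ico, nsmul_eq_mul]
    refine mul_le_mul_of_nonneg_right ?_ hC0
    have : T - m ^ 2 ≤ 2 * m := by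
      have : (m + 1) ^ 2 = m ^ 2 + 2 * m + 1 := by ring
      omega
    exact_mod_cast this
  simp only [Function.comp_apply, Real.norm_eq_abs, abs_div, abs_of_pos hT0, ← hm,
    abs_of_pos (pow_pos hm0 2)]
  calc |∑ t ∈ Finset.range T, w t| / (T : ℝ)
      ≤ (|∑ t ∈ Finset.range (m ^ 2), w t| + 2 * m * C) / T := by
        rw [hsplit]
        gcongr
        exact (abs_add_le _ _).trans (by gcongr)
    _ ≤ (|∑ t ∈ Finset.range (m ^ 2), w t| + 2 * m * C) / (m : ℝ) ^ 2 := by gcongr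
    _ = |∑ t ∈ Finset.range (m ^ 2), w t| / (m : ℝ) ^ 2 + 2 * C * (m : ℝ)⁻¹ := by
        field_simp

section OrthogonalLaw

variable {Ω : Type*} [MeasurableSpace Ω] {μ : Measure Ω} [IsProbabilityMeasure μ]

/-- After expanding the square only the `N` diagonal terms survive, each at most `C ^ 2`. -/
theorem integral_sum_sq_le_of_orthogonal {W : ℕ → Ω → ℝ} {C : ℝ} (hW : ∀ t, Measurable (W t))
    (hC : ∀ t ω, |W t ω| ≤ C) (horth : ∀ s t, s < t → ∫ ω, W s ω * W t ω ∂μ = 0) (N : ℕ) :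
    ∫ ω, (∑ t ∈ Finset.range N, W t ω) ^ 2 ∂μ ≤ N * C ^ 2 := by
  have hint : ∀ s t, Integrable (fun ω => W s ω * W t ω) μ := fun s t =>
    Integrable.of_bound ((hW s).mul (hW t)).aestronglyMeasurable (C * C)
      (ae_of_all _ fun ω => by
        rw [Real.norm_eq_abs, abs_mul]
        exact mul_le_mul (hC s ω) (hC t ω) (abs_nonneg _) ((abs_nonneg _).trans (hC s ω)))
  have hexp : ∀ ω, (∑ t ∈ Finset.range N, W t ω) ^ 2
      = ∑ s ∈ Finset.range N, ∑ t ∈ Finset.range N, W s ω * W t ω := fun ω => by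
    rw [sq, Finset.sum_mul_sum]
  simp_rw [hexp]
  rw [integral_finsetSum _ fun s _ => integrable_finsetSum _ fun t _ => hint s t]
  have hs : ∀ s ∈ Finset.range N, ∫ ω, ∑ t ∈ Finset.range N, W s ω * W t ω ∂μ ≤ C ^ 2 := by
    intro s hs
    rw [integral_finsetSum _ fun t _ => hint s t, Finset.sum_eq_single s]
    · calc ∫ ω, W s ω * W s ω ∂μ ≤ ∫ _, C ^ 2 ∂μ := by
            refine integral_mono (hint s s) (integrable_const _) fun ω => ?_
            have := sq_le_sq' (neg_le_of_abs_le (hC s ω)) (le_of_abs_le (hC s ω))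
            simpa [sq] using this
        _ = C ^ 2 := by simp
    · intro t _ hts
      rcases lt_or_gt_of_ne hts with h | h
      · simpa [mul_comm] using horth t s h
      · exact horth s t h
    · exact fun h => absurd hs h
  simpa using Finset.sum_le_card_nsmul _ _ _ hs

/-- A strong law of large numbers for bounded orthogonal random variables. -/
theorem ae_tendsto_average_of_orthogonal {W : ℕ → Ω → ℝ} {C : ℝ} (hW : ∀ t, Measurable (W t))
    (hC : ∀ t ω, |W t ω| ≤ C) (horth : ∀ s t, s < t → ∫ ω, W s ω * W t ω ∂μ = 0) :
    ∀ᵐ ω ∂μ, Tendsto (fun T : ℕ => (∑ t ∈ Finset.range T, W t ω) / (T : ℝ)) atTop (𝓝 0) := by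
  set A : ℕ → Ω → ℝ := fun m ω => ((∑ t ∈ Finset.range (m ^ 2), W t ω) / (m : ℝ) ^ 2) with hA
  have hAm : ∀ m, Measurable (A m) := fun m =>
    (Finset.measurable_sum _ fun t _ => hW t).div_const _
  have hAb : ∀ m ω, |A m ω| ≤ C := by
    intro m ω
    have hC0 : 0 ≤ C := (abs_nonneg _).trans (hC 0 ω)
    rcases Nat.eq_zero_or_pos m with rfl | hm
    · simpa [hA] using hC0
    have hm0 : (0 : ℝ) < (m : ℝ) ^ 2 := by positivity
    rw [hA]
    simp only
    rw [abs_div, abs_of_pos hm0, div_le_iff₀ hm0]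
    refine (Finset.abs_sum_le_sum_abs _ _).trans ((Finset.sum_le_card_nsmul _ _ C
      fun t _ => hC t ω).trans ?_)
    simp [mul_comm]
  have hAint : ∀ m, ∫ ω, (A m ω) ^ 2 ∂μ ≤ C ^ 2 * (1 / (m : ℝ) ^ 2) := by
    intro m
    rcases Nat.eq_zero_or_pos m with rfl | hm
    · simp [hA]
    have hm0 : (0 : ℝ) < (m : ℝ) ^ 2 := by positivity
    have h := integral_sum_sq_le_of_orthogonal hW hC horth (m ^ 2)
    simp only [hA, div_pow]
    rw [integral_div, div_le_iff₀ (by positivity)]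
    refine h.trans (le_of_eq ?_)
    push_cast
    field_simp
  -- The second moments along the squares are at most `C ^ 2 / m ^ 2`, hence summable. So the series
  -- of the `A m ω ^ 2` is almost surely finite and its terms tend to zero.
  have hsum : ∑' m, ∫⁻ ω, ENNReal.ofReal (A m ω ^ 2) ∂μ ≠ ⊤ := by
    have hle : ∀ m, ∫⁻ ω, ENNReal.ofReal (A m ω ^ 2) ∂μ
        ≤ ENNReal.ofReal (C ^ 2 * (1 / (m : ℝ) ^ 2)) := by
      intro m
      rw [← ofReal_integral_eq_lintegral_ofReal _ (ae_of_all _ fun ω => sq_nonneg _)]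
      · exact ENNReal.ofReal_le_ofReal (hAint m)
      · refine Integrable.of_bound ((hAm m).pow_const 2).aestronglyMeasurable (C ^ 2)
          (ae_of_all _ fun ω => ?_)
        rw [Real.norm_eq_abs, abs_pow]
        exact pow_le_pow_left₀ (abs_nonneg _) (hAb m ω) 2
    refine ne_top_of_le_ne_top ?_ (ENNReal.tsum_le_tsum hle)
    exact ((Real.summable_one_div_nat_pow.2 one_lt_two).mul_left _).tsum_ofReal_ne_top
  rw [← lintegral_tsum fun m => ((hAm m).pow_const 2).ennreal_ofReal.aemeasurable] at hsum
  have hfin := ae_lt_top' (AEMeasurable.tsum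
    fun m => ((hAm m).pow_const 2).ennreal_ofReal.aemeasurable) hsum
  filter_upwards [hfin] with ω hω
  refine tendsto_average_of_tendsto_average_sq (fun t => hC t ω) ?_
  have h0 := ENNReal.tendsto_atTop_zero_of_tsum_ne_top hω.ne
  have h1 : Tendsto (fun m => A m ω ^ 2) atTop (𝓝 0) := by
    have := (ENNReal.tendsto_toReal ENNReal.zero_ne_top).comp h0
    simpa [Function.comp_def, ENNReal.toReal_ofReal (sq_nonneg _)] using this
  have h2 := (Real.continuous_sqrt.tendsto 0).comp h1
  rw [Real.sqrt_zero] at h2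
  rw [tendsto_zero_iff_abs_tendsto_zero]
  refine h2.congr fun m => ?_
  simp [Real.sqrt_sq_eq_abs, hA]

end OrthogonalLaw

/-! ### Exponential clocks: memorylessness and the race between senders. -/

section Exponential

variable {r : ℝ}

theorem exponentialPDF_add {w y : ℝ} (hw : 0 ≤ w) (hy : 0 ≤ y) :
    exponentialPDF r (w + y) = ENNReal.ofReal (Real.exp (-(r * y))) * exponentialPDF r w := by
  rw [exponentialPDF_of_nonneg hw, exponentialPDF_of_nonneg (add_nonneg hw hy),
    ← ENNReal.ofReal_mul (Real.exp_pos _).le]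
  congr 1
  rw [mul_add, neg_add, Real.exp_add]
  ring

theorem expMeasure_apply {B : Set ℝ} (hB : MeasurableSet B) :
    expMeasure r B = ∫⁻ z, B.indicator (exponentialPDF r) z := by
  rw [lintegral_indicator hB]
  exact withDensity_apply _ hB

theorem ae_nonneg_expMeasure : ∀ᵐ y ∂(expMeasure r), 0 ≤ y := by
  rw [ae_iff]
  simp only [not_le]
  change expMeasure r (Set.Iio 0) = 0
  rw [expMeasure_apply measurableSet_Iio, lintegral_indicator measurableSet_Iio]
  exact lintegral_exponentialPDF_of_nonpos le_rfl

theorem expMeasure_singleton (y : ℝ) : expMeasure r {y} = 0 :=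
  withDensity_absolutelyContinuous _ _ Real.volume_singleton

/-- The exponential distribution is memoryless. -/
theorem expMeasure_memoryless {y : ℝ} (hy : 0 ≤ y) {B : Set ℝ}
    (hB : MeasurableSet B) :
    expMeasure r {z | y ≤ z ∧ z - y ∈ B}
      = ENNReal.ofReal (Real.exp (-(r * y))) * expMeasure r B := by
  have hm : MeasurableSet {z : ℝ | y ≤ z ∧ z - y ∈ B} :=
    measurableSet_Ici.inter ((measurable_id.sub_const y) hB)
  rw [expMeasure_apply hm, expMeasure_apply hB,
    ← lintegral_add_right_eq_self _ y, ← lintegral_const_mul']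
  · refine lintegral_congr fun w => ?_
    by_cases hw : 0 ≤ w
    · by_cases hwB : w ∈ B
      · rw [Set.indicator_of_mem (by simpa using ⟨hw, hwB⟩), Set.indicator_of_mem hwB,
          exponentialPDF_add hw hy]
      · rw [Set.indicator_of_notMem (by simp [hwB]), Set.indicator_of_notMem hwB, mul_zero]
    · rw [Set.indicator_of_notMem (by simp [hw])]
      by_cases hwB : w ∈ B
      · rw [Set.indicator_of_mem hwB, exponentialPDF_of_neg (not_le.1 hw), mul_zero]
      · rw [Set.indicator_of_notMem hwB, mul_zero]
  · exact ENNReal.ofReal_ne_top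

end Exponential

namespace MixInput

theorem earliest_le {n : ℕ} [NeZero n] (c : Fin n → ℝ) (j : Fin n) : c (earliest c) ≤ c j := by
  have h := Finset.min'_mem (Finset.univ.filter fun i => ∀ j, c i ≤ c j) (by
    obtain ⟨i, hi⟩ := Finite.exists_min c
    exact ⟨i, by simpa using hi⟩)
  exact (Finset.mem_filter.1 h).2 j

theorem earliest_eq_of_lt {n : ℕ} [NeZero n] {c : Fin n → ℝ} {i : Fin n}
    (h : ∀ j, j ≠ i → c i < c j) : earliest c = i := by
  by_contra hne
  exact absurd (earliest_le c i) (not_le.2 (h _ hne))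

/-- Allows absolute arrival times to be replaced by residual times, from which they differ by a
common shift. -/
theorem earliest_sub_const {n : ℕ} [NeZero n] (c : Fin n → ℝ) (m : ℝ) :
    earliest (fun i => c i - m) = earliest c := by
  unfold earliest
  simp

theorem measurable_earliest {n : ℕ} [NeZero n] :
    Measurable (earliest : (Fin n → ℝ) → Fin n) := by
  refine measurable_to_countable' fun i => ?_
  have : (earliest : (Fin n → ℝ) → Fin n) ⁻¹' {i}
      = {c | ∀ j, c i ≤ c j} ∩ {c | ∀ i' < i, ¬ ∀ j, c i' ≤ c j} := by
    ext c
    simp only [Set.mem_preimage, Set.mem_singleton_iff, Set.mem_inter_iff, Set.mem_ofPred_eq]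
    constructor
    · rintro rfl
      refine ⟨earliest_le c, fun i' hi' h => absurd hi' (not_lt.2 ?_)⟩
      exact Finset.min'_le _ _ (by simpa using h)
    · rintro ⟨h1, h2⟩
      refine le_antisymm (Finset.min'_le _ _ (by simpa using h1)) ?_
      by_contra h
      exact h2 _ (not_le.1 h) (earliest_le c)
  rw [this]
  measurability

end MixInput

section Race

open MixInput

variable {r : ℝ}

/-- Conditionally on the value `y` of clock `s`, each other clock exceeds `y` with probability `exp
(-(r * y))`, and its excess is again exponential. The weak inequality makes the section at `y` a
product set. -/
theorem pi_expMeasure_weak_race (hr : 0 < r) {m : ℕ} (s : Fin (m + 1)) {B : Fin (m + 1) → Set ℝ}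
    (hB : ∀ i, MeasurableSet (B i)) :
    Measure.pi (fun _ : Fin (m + 1) => expMeasure r)
        {d | ∀ i, i ≠ s → d s ≤ d i ∧ d i - d s ∈ B i}
      = (∫⁻ y, ENNReal.ofReal (Real.exp (-(r * y))) ^ m ∂(expMeasure r))
        * ∏ i : Fin m, expMeasure r (B (s.succAbove i)) := by
  have := isProbabilityMeasure_expMeasure hr
  set Q : Set (ℝ × (Fin m → ℝ)) := {q | ∀ i, q.1 ≤ q.2 i ∧ q.2 i - q.1 ∈ B (s.succAbove i)}
  have hQ : MeasurableSet Q := by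
    simp only [Q, Set.ofPred_forall]
    refine MeasurableSet.iInter fun i => ?_
    have h1 : MeasurableSet {q : ℝ × (Fin m → ℝ) | q.1 ≤ q.2 i} :=
      measurableSet_le measurable_fst ((measurable_pi_apply i).comp measurable_snd)
    have h2 : Measurable fun q : ℝ × (Fin m → ℝ) => q.2 i - q.1 := by fun_prop
    exact h1.inter (h2 (hB _))
  have hpre : {d : Fin (m + 1) → ℝ | ∀ i, i ≠ s → d s ≤ d i ∧ d i - d s ∈ B i}
      = MeasurableEquiv.piFinSuccAbove (fun _ => ℝ) s ⁻¹' Q := by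
    ext d
    simp only [Set.mem_ofPred_eq, Set.mem_preimage, Q]
    constructor
    · exact fun h i => h _ (Fin.succAbove_ne s i)
    · intro h i hi
      obtain ⟨i', rfl⟩ := Fin.exists_succAbove_eq hi
      exact h i'
  rw [hpre, (measurePreserving_piFinSuccAbove (fun _ => expMeasure r) s).measure_preimage
    hQ.nullMeasurableSet, Measure.prod_apply hQ, ← lintegral_mul_const']
  · refine lintegral_congr_ae ?_
    filter_upwards [ae_nonneg_expMeasure (r := r)] with y hy
    have : Prod.mk y ⁻¹' Q = Set.univ.pi fun i => {z | y ≤ z ∧ z - y ∈ B (s.succAbove i)} := by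
      ext z
      simp [Q]
    rw [this, Measure.pi_pi]
    simp_rw [expMeasure_memoryless hy (hB _)]
    rw [Finset.prod_mul_distrib]
    simp
  · exact ENNReal.prod_ne_top fun i _ => measure_ne_top _ _

theorem pi_expMeasure_race_aux (hr : 0 < r) {m : ℕ} [NeZero (m + 1)] (s : Fin (m + 1))
    {B : Fin (m + 1) → Set ℝ} (hB : ∀ i, MeasurableSet (B i)) :
    Measure.pi (fun _ : Fin (m + 1) => expMeasure r)
        {d | earliest d = s ∧ ∀ i, i ≠ s → d i - d s ∈ B i}
      = (∫⁻ y, ENNReal.ofReal (Real.exp (-(r * y))) ^ m ∂(expMeasure r))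
        * ∏ i : Fin m, expMeasure r (B (s.succAbove i)) := by
  refine le_antisymm ?_ ?_
  · rw [← pi_expMeasure_weak_race hr s hB]
    refine measure_mono ?_
    rintro d ⟨rfl, h⟩ i hi
    exact ⟨earliest_le d i, h i hi⟩
  -- Ties are null: removing the excess `0` costs nothing and makes `s` the strict minimum, so the
  -- tie-breaking rule of `earliest` is irrelevant.
  · have h0 : ∀ i, expMeasure r (B i \ {0}) = expMeasure r (B i) := fun i =>
      measure_sdiff_null (expMeasure_singleton 0)
    calc _ = (∫⁻ y, ENNReal.ofReal (Real.exp (-(r * y))) ^ m ∂(expMeasure r))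
            * ∏ i : Fin m, expMeasure r (B (s.succAbove i) \ {0}) := by simp_rw [h0]
      _ = _ := (pi_expMeasure_weak_race hr s (B := fun i => B i \ {0})
            fun i => (hB i).diff (measurableSet_singleton 0)).symm
      _ ≤ _ := by
        refine measure_mono fun d hd => ⟨earliest_eq_of_lt fun i hi => ?_, fun i hi =>
          (hd i hi).2.1⟩
        refine lt_of_le_of_ne (hd i hi).1 fun h => (hd i hi).2.2 ?_
        simp [h]

/-- No integration is needed: the integral is the probability that a given one of `m + 1` clocks
wins, it is the same for all of them, and these probabilities add up to one. -/
theorem lintegral_exp_pow_expMeasure (hr : 0 < r) (m : ℕ) :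
    ∫⁻ y, ENNReal.ofReal (Real.exp (-(r * y))) ^ m ∂(expMeasure r) = ((m + 1 : ℕ) : ENNReal)⁻¹ := by
  have := isProbabilityMeasure_expMeasure hr
  set ν := Measure.pi (fun _ : Fin (m + 1) => expMeasure r)
  have h1 : ∑ s : Fin (m + 1), ν (earliest ⁻¹' {s}) = 1 := by
    rw [sum_measure_preimage_singleton _ fun s _ =>
      measurable_earliest (measurableSet_singleton s)]
    simp
  have h2 : ∀ s : Fin (m + 1), ν (earliest ⁻¹' {s})
      = ∫⁻ y, ENNReal.ofReal (Real.exp (-(r * y))) ^ m ∂(expMeasure r) := by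
    intro s
    have := pi_expMeasure_race_aux hr s (B := fun _ => Set.univ) fun _ => MeasurableSet.univ
    simp only [Set.mem_univ, implies_true, and_true, measure_univ, Finset.prod_const_one,
      mul_one] at this
    exact this
  simp_rw [h2] at h1
  rw [Finset.sum_const, Finset.card_univ, Fintype.card_fin, nsmul_eq_mul] at h1
  exact ENNReal.eq_inv_of_mul_eq_one_left (by rw [mul_comm]; exact h1)

/-- Competing exponential clocks: each of them is equally likely to be the first, and the residual
times of the others are again independent and exponential. -/
theorem pi_expMeasure_race (hr : 0 < r) {n : ℕ} [NeZero n] (s : Fin n)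
    {B : Fin n → Set ℝ} (hB : ∀ i, MeasurableSet (B i)) :
    Measure.pi (fun _ : Fin n => expMeasure r)
        {d | earliest d = s ∧ ∀ i, i ≠ s → d i - d s ∈ B i} * expMeasure r (B s)
      = (n : ENNReal)⁻¹ * ∏ i, expMeasure r (B i) := by
  obtain _ | m := n
  · exact s.elim0
  rw [pi_expMeasure_race_aux hr s hB, lintegral_exp_pow_expMeasure hr,
    Fin.prod_univ_succAbove _ s]
  ring

end Race

/-! ### Evolution along a prescribed path of steps. -/

namespace MixInput

variable {n : ℕ} {R : Type*}

/-- The number of messages of each sender among the first `t` arrivals, if these arrivals and the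
release sets are as prescribed by `z`. -/
def pathSent (z : ℕ → Fin n × Finset (Fin n)) : ℕ → Fin n → ℕ
  | 0 => fun _ => 0
  | t + 1 => Function.update (pathSent z t) (z t).1 (pathSent z t (z t).1 + 1)

/-- The residual times until the next message of each sender after `t` arrivals as prescribed by
`z`. -/
def residualTime (x : MixInput n R) (z : ℕ → Fin n × Finset (Fin n)) : ℕ → Fin n → ℝ
  | 0 => fun i => x.gap i 0
  | t + 1 => Function.update (fun i => x.residualTime z t i - x.residualTime z t (z t).1) (z t).1
      (x.gap (z t).1 (pathSent z t (z t).1 + 1))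

theorem pathSent_le_succ (z : ℕ → Fin n × Finset (Fin n)) (t : ℕ) (i : Fin n) :
    pathSent z t i ≤ pathSent z (t + 1) i := by
  rw [pathSent, Function.update_apply]
  split_ifs with h
  · subst h; exact Nat.le_succ _
  · exact le_rfl

/-- The common shift `m` is the time elapsed up to the last arrival on the path. -/
theorem exists_arrivalTime_eq_residual_add (x : MixInput n R) (z : ℕ → Fin n × Finset (Fin n))
    (t : ℕ) : ∃ m, ∀ i, x.arrivalTime i (pathSent z t i) = x.residualTime z t i + m := by
  induction t with
  | zero => exact ⟨0, fun i => by simp [arrivalTime, pathSent, residualTime]⟩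
  | succ t ih =>
    obtain ⟨m, hm⟩ := ih
    refine ⟨x.residualTime z t (z t).1 + m, fun i => ?_⟩
    rw [pathSent, residualTime, Function.update_apply, Function.update_apply]
    split_ifs with h
    · rw [arrivalTime, Finset.sum_range_succ]
      have := hm (z t).1
      rw [arrivalTime] at this
      rw [h, this]
      ring
    · rw [hm]; ring

variable [NeZero n]

/-- The sender of the `t`-th arrival and the set of queues which it releases. -/
noncomputable def step (x : MixInput n R) (t : ℕ) : Fin n × Finset (Fin n) :=
  (x.sender t, x.released t)

theorem sent_succ (x : MixInput n R) (t : ℕ) :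
    x.sent (t + 1) = Function.update (x.sent t) (x.sender t) (x.sent t (x.sender t) + 1) := rfl

theorem sent_eq_pathSent (x : MixInput n R) {z : ℕ → Fin n × Finset (Fin n)} {t : ℕ}
    (h : ∀ u < t, x.step u = z u) : x.sent t = pathSent z t := by
  induction t with
  | zero => rfl
  | succ t ih =>
    rw [sent_succ, pathSent, ih fun u hu => h u (hu.trans t.lt_succ_self),
      ← h t t.lt_succ_self]
    rfl

theorem sender_eq_earliest_residual (x : MixInput n R) {z : ℕ → Fin n × Finset (Fin n)} {t : ℕ}
    (h : ∀ u < t, x.step u = z u) : x.sender t = earliest (x.residualTime z t) := by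
  obtain ⟨m, hm⟩ := x.exists_arrivalTime_eq_residual_add z t
  rw [sender, sent_eq_pathSent x h, ← earliest_sub_const _ m]
  congr 1
  funext i
  rw [hm]
  ring

/-- Along a prescribed path the random message indices become deterministic, so the next step is an
event about fixed primitive variables. -/
theorem step_eq_iff (x : MixInput n R) {z : ℕ → Fin n × Finset (Fin n)} {t : ℕ}
    (h : ∀ u < t, x.step u = z u) :
    x.step t = z t ↔ earliest (x.residualTime z t) = (z t).1 ∧
      x.release (z t).1 (pathSent z t (z t).1) = (z t).2 := by
  rw [step, released, Prod.ext_iff, sent_eq_pathSent x h, sender_eq_earliest_residual x h]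
  constructor
  · rintro ⟨h1, h2⟩
    simp only at h1 h2
    rw [h1] at h2
    exact ⟨h1, h2⟩
  · rintro ⟨h1, h2⟩
    simp only [h1]
    exact ⟨trivial, h2⟩

end MixInput

/-! ### The joint law of the steps. -/

/-- The probability that an arrival comes from `z.1` and releases the queues in `z.2`. -/
noncomputable def stepWeight (n k : ℕ) (p : ℝ) (z : Fin n × Finset (Fin n)) : ENNReal :=
  (n : ENNReal)⁻¹ * ENNReal.ofReal (releaseProb n k p z.1 z.2)

namespace SamplingMix

open MixInput

variable {n k : ℕ} {p : ℝ} {R Ω : Type*} [MeasurableSpace Ω] {μ : Measure Ω}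

/-- The primitive random variables which determine the evolution along the path `z` up to the
`t`-th arrival. -/
def pastSources (z : ℕ → Fin n × Finset (Fin n)) (t : ℕ) : Set (MixSource n) :=
  {v | match v with
    -- The gap preceding the pending message already enters the residual time, whereas its release
    -- set is still unused; hence `≤` here and `<` below.
    | .gap i l => l ≤ pathSent z t i
    | .dest _ _ => False
    | .release i l => l < pathSent z t i
    | .init => True}

/-- The σ-algebra of the evolution along the path `z` up to the `t`-th arrival. -/
@[reducible]
def past (X : SamplingMix n k p R μ) (z : ℕ → Fin n × Finset (Fin n)) (t : ℕ) :
    MeasurableSpace Ω :=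
  ⨆ v ∈ pastSources z t, v.sigma X.input

/-- The σ-algebra of everything but the addresses of the arriving messages. -/
@[reducible]
def undirected (X : SamplingMix n k p R μ) : MeasurableSpace Ω :=
  ⨆ v ∈ {v : MixSource n | ∀ i l, v ≠ .dest i l}, v.sigma X.input

theorem past_mono (X : SamplingMix n k p R μ) (z : ℕ → Fin n × Finset (Fin n)) (t : ℕ) :
    X.past z t ≤ X.past z (t + 1) := by
  refine biSup_mono fun v hv => ?_
  cases v with
  | gap i l => exact le_trans (b := pathSent z t i) hv (pathSent_le_succ z t i)
  | dest i l => exact hv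
  | release i l => exact lt_of_lt_of_le (b := pathSent z t i) hv (pathSent_le_succ z t i)
  | init => trivial

theorem past_le_undirected (X : SamplingMix n k p R μ) (z : ℕ → Fin n × Finset (Fin n)) (t : ℕ) :
    X.past z t ≤ X.undirected := by
  refine biSup_mono fun v hv i l h => ?_
  subst h
  exact hv

theorem sigma_le_past (X : SamplingMix n k p R μ) {z : ℕ → Fin n × Finset (Fin n)} {t : ℕ}
    {v : MixSource n} (hv : v ∈ pastSources z t) : v.sigma X.input ≤ X.past z t :=
  le_biSup (fun v : MixSource n => v.sigma X.input) hv

theorem past_le (X : SamplingMix n k p R μ) (z : ℕ → Fin n × Finset (Fin n)) (t : ℕ) :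
    X.past z t ≤ ‹MeasurableSpace Ω› :=
  iSup₂_le fun v _ => X.sigma_le v

theorem undirected_le (X : SamplingMix n k p R μ) : X.undirected ≤ ‹MeasurableSpace Ω› :=
  iSup₂_le fun v _ => X.sigma_le v

theorem measurable_residualTime (X : SamplingMix n k p R μ) (z : ℕ → Fin n × Finset (Fin n)) (t : ℕ)
    (i : Fin n) : Measurable[X.past z t] fun ω => (X.input ω).residualTime z t i := by
  have hgap : ∀ t i l, l ≤ pathSent z t i →
      Measurable[X.past z t] fun ω => (X.input ω).gap i l := fun t i l h =>
    (comap_measurable _).mono (X.sigma_le_past (v := .gap i l) h) le_rfl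
  induction t generalizing i with
  | zero => exact hgap 0 i 0 (Nat.zero_le _)
  | succ t ih =>
    by_cases h : i = (z t).1
    · subst h
      simp only [residualTime, Function.update_self]
      refine hgap (t + 1) _ _ ?_
      simp [pathSent]
    · simp only [residualTime, Function.update_of_ne h]
      exact ((ih i).mono (X.past_mono z t) le_rfl).sub ((ih _).mono (X.past_mono z t) le_rfl)

theorem measurable_gap (X : SamplingMix n k p R μ) (i : Fin n) (l : ℕ) :
    Measurable fun ω => (X.input ω).gap i l :=
  (comap_measurable _).mono (X.sigma_le (.gap i l)) le_rfl

theorem measure_gap_preimage (X : SamplingMix n k p R μ) (i : Fin n) (l : ℕ) {B : Set ℝ}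
    (hB : MeasurableSet B) : μ {ω | (X.input ω).gap i l ∈ B} = expMeasure X.rate B := by
  rw [← X.law_gap i l, Measure.map_apply (X.measurable_gap i l) hB]
  rfl

/-- Base case of the induction on arrivals: the initial contents and the first gaps are distinct
primitive variables. -/
theorem measure_init_inter_gap (X : SamplingMix n k p R μ) (b : Fin n → List R)
    {B : Fin n → Set ℝ} (hB : ∀ i, MeasurableSet (B i)) :
    μ ({ω | (X.input ω).init = b} ∩ {ω | ∀ i, (X.input ω).gap i 0 ∈ B i})
      = μ {ω | (X.input ω).init = b} * ∏ i, expMeasure X.rate (B i) := by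
  let g : Option (Fin n) → MixSource n := fun o => o.elim .init fun i => .gap i 0
  have hg : Function.Injective g := by
    rintro (_ | i) (_ | j) h <;> simp_all [g]
  have hind := X.indep.precomp hg
  let E : Option (Fin n) → Set Ω := fun o =>
    o.elim {ω | (X.input ω).init = b} fun i => {ω | (X.input ω).gap i 0 ∈ B i}
  have hE : ∀ o, MeasurableSet[(g o).sigma X.input] (E o) := by
    rintro (_ | i)
    · exact ⟨{b}, trivial, rfl⟩
    · exact ⟨B i, hB i, rfl⟩
  have h := hind.meas_iInter hE
  rw [Fintype.prod_option] at h
  simp only [E, Option.elim_none, Option.elim_some, X.measure_gap_preimage _ _ (hB _)] at h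
  rw [← h]
  congr 1
  ext ω
  simp [Option.forall]

/-- The next arrival draws the gap with index `pathSent + 1` and the release set with index
`pathSent` of its sender. Both lie just outside `pastSources`, so they are independent of the past
and of each other. -/
theorem measure_fresh (X : SamplingMix n k p R μ) (z : ℕ → Fin n × Finset (Fin n)) (t : ℕ)
    {G : Set Ω} (hG : MeasurableSet[X.past z t] G) {B : Set ℝ} (hB : MeasurableSet B) :
    μ (G ∩ ({ω | (X.input ω).gap (z t).1 (pathSent z t (z t).1 + 1) ∈ B} ∩
      {ω | (X.input ω).release (z t).1 (pathSent z t (z t).1) = (z t).2}))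
      = μ G * (expMeasure X.rate B * ENNReal.ofReal (releaseProb n k p (z t).1 (z t).2)) := by
  set v₁ : MixSource n := .gap (z t).1 (pathSent z t (z t).1 + 1)
  set v₂ : MixSource n := .release (z t).1 (pathSent z t (z t).1)
  have h₁ : MeasurableSet[v₁.sigma X.input]
      {ω | (X.input ω).gap (z t).1 (pathSent z t (z t).1 + 1) ∈ B} := ⟨B, hB, rfl⟩
  have h₂ : MeasurableSet[v₂.sigma X.input]
      {ω | (X.input ω).release (z t).1 (pathSent z t (z t).1) = (z t).2} :=
    ⟨{(z t).2}, trivial, rfl⟩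
  have hdisj : Disjoint (pastSources z t) {v₁, v₂} := by
    rw [Set.disjoint_right]
    rintro v (rfl | rfl) <;> simp [pastSources, v₁, v₂]
  have hind := indep_iSup_of_disjoint X.sigma_le X.indep hdisj
  have hv₁ : v₁.sigma X.input ≤ ⨆ v ∈ ({v₁, v₂} : Set (MixSource n)), v.sigma X.input :=
    le_biSup (fun v : MixSource n => v.sigma X.input) (by simp)
  have hv₂ : v₂.sigma X.input ≤ ⨆ v ∈ ({v₁, v₂} : Set (MixSource n)), v.sigma X.input :=
    le_biSup (fun v : MixSource n => v.sigma X.input) (by simp)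
  rw [(Indep_iff _ _ μ).1 hind G _ hG (MeasurableSet.inter (hv₁ _ h₁) (hv₂ _ h₂)),
    (Indep_iff _ _ μ).1 (X.indep.indep (i := v₁) (j := v₂) (by simp [v₁, v₂])) _ _ h₁ h₂,
    X.measure_gap_preimage _ _ hB, X.law_release]

variable [NeZero n]

/-- The event that the initial contents are `b` and the first `t` steps are as prescribed. -/
def pathEvent (X : SamplingMix n k p R μ) (b : Fin n → List R)
    (z : ℕ → Fin n × Finset (Fin n)) (t : ℕ) : Set Ω :=
  {ω | (X.input ω).init = b ∧ ∀ u < t, (X.input ω).step u = z u}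

theorem pathEvent_succ (X : SamplingMix n k p R μ) (b : Fin n → List R)
    (z : ℕ → Fin n × Finset (Fin n)) (t : ℕ) :
    X.pathEvent b z (t + 1) = (X.pathEvent b z t ∩
      {ω | earliest ((X.input ω).residualTime z t) = (z t).1}) ∩
      {ω | (X.input ω).release (z t).1 (pathSent z t (z t).1) = (z t).2} := by
  ext ω
  simp only [pathEvent, Set.mem_ofPred_eq, Set.mem_inter_iff, Nat.lt_succ_iff_lt_or_eq]
  constructor
  · rintro ⟨h0, h⟩
    have h1 : ∀ u < t, (X.input ω).step u = z u := fun u hu => h u (Or.inl hu)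
    have h2 := ((X.input ω).step_eq_iff h1).1 (h t (Or.inr rfl))
    exact ⟨⟨⟨h0, h1⟩, h2.1⟩, h2.2⟩
  · rintro ⟨⟨⟨h0, h1⟩, h2⟩, h3⟩
    refine ⟨h0, fun u hu => ?_⟩
    rcases hu with hu | rfl
    · exact h1 u hu
    · exact ((X.input ω).step_eq_iff h1).2 ⟨h2, h3⟩

theorem measurableSet_pathEvent (X : SamplingMix n k p R μ) (b : Fin n → List R)
    (z : ℕ → Fin n × Finset (Fin n)) (t : ℕ) : MeasurableSet[X.past z t] (X.pathEvent b z t) := by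
  induction t with
  | zero =>
    refine X.sigma_le_past (v := .init) trivial _ ⟨{b}, trivial, ?_⟩
    ext ω
    simp [pathEvent]
  | succ t ih =>
    rw [pathEvent_succ]
    refine MeasurableSet.inter (MeasurableSet.inter (X.past_mono z t _ ih) (X.past_mono z t _ ?_))
      ?_
    · have h : Measurable[X.past z t] fun ω => (X.input ω).residualTime z t :=
        @measurable_pi_lambda _ _ _ (X.past z t) _ _ (X.measurable_residualTime z t)
      exact (measurable_earliest.comp h) (measurableSet_singleton (z t).1)
    · refine X.sigma_le_past (v := .release (z t).1 (pathSent z t (z t).1)) ?_ _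
        ⟨{(z t).2}, trivial, rfl⟩
      simp [pastSources, pathSent]

variable [IsProbabilityMeasure μ]

/-- Boxes form a π-system that generates the product σ-algebra. The extension is needed because the
race condition on the residual times is not a box. -/
theorem measure_pathEvent_inter_of_forall_box (X : SamplingMix n k p R μ) {b : Fin n → List R}
    {z : ℕ → Fin n × Finset (Fin n)} {t : ℕ} {w : ENNReal}
    (h : ∀ B : Fin n → Set ℝ, (∀ i, MeasurableSet (B i)) →
      μ (X.pathEvent b z t ∩ {ω | ∀ i, (X.input ω).residualTime z t i ∈ B i})
        = w * ∏ i, expMeasure X.rate (B i))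
    {Q : Set (Fin n → ℝ)} (hQ : MeasurableSet Q) :
    μ (X.pathEvent b z t ∩ {ω | (X.input ω).residualTime z t ∈ Q})
      = w * Measure.pi (fun _ => expMeasure X.rate) Q := by
  have := isProbabilityMeasure_expMeasure X.rate_pos
  have hres : Measurable fun ω => (X.input ω).residualTime z t :=
    measurable_pi_lambda _ fun i => (X.measurable_residualTime z t i).mono (X.past_le z t) le_rfl
  have hP : MeasurableSet (X.pathEvent b z t) := X.past_le z t _ (X.measurableSet_pathEvent b z t)
  have hmap : ∀ Q : Set (Fin n → ℝ), MeasurableSet Q →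
      (μ.restrict (X.pathEvent b z t)).map (fun ω => (X.input ω).residualTime z t) Q
        = μ (X.pathEvent b z t ∩ {ω | (X.input ω).residualTime z t ∈ Q}) := fun Q hQ => by
    rw [Measure.map_apply hres hQ, Measure.restrict_apply (hres hQ), Set.inter_comm]
    rfl
  have hbox : ∀ B : Fin n → Set ℝ, (∀ i, MeasurableSet (B i)) →
      (μ.restrict (X.pathEvent b z t)).map (fun ω => (X.input ω).residualTime z t) (Set.univ.pi B)
        = (w • Measure.pi fun _ => expMeasure X.rate) (Set.univ.pi B) := fun B hB => by
    rw [hmap _ (MeasurableSet.univ_pi hB), Measure.smul_apply, Measure.pi_pi, smul_eq_mul, ← h B hB]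
    congr 2
    ext ω
    simp
  have heq : (μ.restrict (X.pathEvent b z t)).map (fun ω => (X.input ω).residualTime z t)
      = w • Measure.pi fun _ => expMeasure X.rate := by
    have hfin : IsFiniteMeasure ((μ.restrict (X.pathEvent b z t)).map
        fun ω => (X.input ω).residualTime z t) := inferInstance
    refine ext_of_generate_finite _ generateFrom_pi.symm isPiSystem_pi ?_ ?_
    · rintro _ ⟨B, hB, rfl⟩
      exact hbox B fun i => hB i trivial
    · simpa using hbox (fun _ => Set.univ) fun _ => MeasurableSet.univ
  rw [← hmap Q hQ, heq, Measure.smul_apply, smul_eq_mul]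

/-- The induction must carry the residual times along: given the path so far they are again
independent exponential clocks, and this is what gives the next step its weight. -/
theorem measure_pathEvent_inter_box (X : SamplingMix n k p R μ) (b : Fin n → List R)
    (z : ℕ → Fin n × Finset (Fin n)) (t : ℕ) {B : Fin n → Set ℝ} (hB : ∀ i, MeasurableSet (B i)) :
    μ (X.pathEvent b z t ∩ {ω | ∀ i, (X.input ω).residualTime z t i ∈ B i})
      = (μ {ω | (X.input ω).init = b} * ∏ u ∈ Finset.range t, stepWeight n k p (z u))
        * ∏ i, expMeasure X.rate (B i) := by
  induction t generalizing B with
  | zero =>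
    rw [Finset.range_zero, Finset.prod_empty, mul_one, ← X.measure_init_inter_gap b hB]
    simp [pathEvent, residualTime]
  | succ t ih =>
    set Q : Set (Fin n → ℝ) := {d | earliest d = (z t).1 ∧ ∀ i, i ≠ (z t).1 → d i - d (z t).1 ∈ B i}
    have hQ : MeasurableSet Q := by
      have h : MeasurableSet {d : Fin n → ℝ | ∀ i, i ≠ (z t).1 → d i - d (z t).1 ∈ B i} := by
        simp only [Set.ofPred_forall]
        refine MeasurableSet.iInter fun i => MeasurableSet.iInter fun _ => ?_
        have : Measurable fun d : Fin n → ℝ => d i - d (z t).1 := by fun_prop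
        exact this (hB i)
      exact (measurable_earliest (measurableSet_singleton (z t).1)).inter h
    have hset : X.pathEvent b z (t + 1) ∩ {ω | ∀ i, (X.input ω).residualTime z (t + 1) i ∈ B i}
        = (X.pathEvent b z t ∩ {ω | (X.input ω).residualTime z t ∈ Q}) ∩
          ({ω | (X.input ω).gap (z t).1 (pathSent z t (z t).1 + 1) ∈ B (z t).1} ∩
          {ω | (X.input ω).release (z t).1 (pathSent z t (z t).1) = (z t).2}) := by
      rw [pathEvent_succ]
      ext ω
      simp only [Set.mem_inter_iff, Set.mem_ofPred_eq, Q, residualTime]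
      have : (∀ i, Function.update (fun i => (X.input ω).residualTime z t i -
          (X.input ω).residualTime z t (z t).1) (z t).1
          ((X.input ω).gap (z t).1 (pathSent z t (z t).1 + 1)) i ∈ B i) ↔
          (X.input ω).gap (z t).1 (pathSent z t (z t).1 + 1) ∈ B (z t).1 ∧ ∀ i, i ≠ (z t).1 →
            (X.input ω).residualTime z t i - (X.input ω).residualTime z t (z t).1 ∈ B i := by
        constructor
        · intro h
          refine ⟨by simpa using h (z t).1, fun i hi => ?_⟩
          simpa [Function.update_of_ne hi] using h i
        · rintro ⟨h1, h2⟩ i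
          by_cases hi : i = (z t).1
          · rw [hi]; simpa using h1
          · simpa [Function.update_of_ne hi] using h2 i hi
      rw [this]
      tauto
    have hres : Measurable[X.past z t] fun ω => (X.input ω).residualTime z t :=
      @measurable_pi_lambda _ _ _ (X.past z t) _ _ (X.measurable_residualTime z t)
    rw [hset, X.measure_fresh z t (G := X.pathEvent b z t ∩ {ω | (X.input ω).residualTime z t ∈ Q})
        (MeasurableSet.inter (X.measurableSet_pathEvent b z t) (hres hQ)) (hB (z t).1), X.measure_pathEvent_inter_of_forall_box (fun B hB => ih hB) hQ,
      Finset.prod_range_succ]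
    calc _ = (μ {ω | (X.input ω).init = b} * ∏ u ∈ Finset.range t, stepWeight n k p (z u))
          * (Measure.pi (fun _ => expMeasure X.rate) Q * expMeasure X.rate (B (z t).1))
          * ENNReal.ofReal (releaseProb n k p (z t).1 (z t).2) := by ring
      -- The fresh gap of the sender fills the coordinate that won the race, so the product over all
      -- senders is restored.
      _ = _ := by
        rw [pi_expMeasure_race X.rate_pos (z t).1 hB, stepWeight]
        ring

/-- The steps of a mix are independent and identically distributed, and independent of the initial
contents of the queues. -/
theorem measure_pathEvent (X : SamplingMix n k p R μ) (b : Fin n → List R)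
    (z : ℕ → Fin n × Finset (Fin n)) (t : ℕ) :
    μ (X.pathEvent b z t)
      = μ {ω | (X.input ω).init = b} * ∏ u ∈ Finset.range t, stepWeight n k p (z u) := by
  have := isProbabilityMeasure_expMeasure X.rate_pos
  simpa using X.measure_pathEvent_inter_box b z t (B := fun _ => Set.univ)
    fun _ => MeasurableSet.univ

end SamplingMix

/-! ### Histories, and the law of large numbers for steps. -/

/-- The indicator of a proposition. -/
noncomputable def ind (P : Prop) : ℝ := open Classical in if P then 1 else 0

theorem ind_of_true {P : Prop} (h : P) : ind P = 1 := by simp [ind, h]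

theorem ind_of_false {P : Prop} (h : ¬ P) : ind P = 0 := by simp [ind, h]

theorem ind_nonneg (P : Prop) : 0 ≤ ind P := by unfold ind; split_ifs <;> norm_num

theorem ind_le_one (P : Prop) : ind P ≤ 1 := by unfold ind; split_ifs <;> norm_num

theorem ind_and (P Q : Prop) : ind (P ∧ Q) = ind P * ind Q := by
  by_cases hP : P <;> by_cases hQ : Q <;> simp [ind, hP, hQ]

theorem ind_congr {P Q : Prop} (h : P ↔ Q) : ind P = ind Q := by rw [propext h]

theorem measurable_ind {α : Type*} [MeasurableSpace α] {P : α → Prop}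
    (h : MeasurableSet {x | P x}) : Measurable fun x => ind (P x) := by
  classical
  unfold ind
  exact Measurable.ite h measurable_const measurable_const

theorem integral_ind {Ω : Type*} [MeasurableSpace Ω] {μ : Measure Ω} {P : Ω → Prop}
    (h : MeasurableSet {x | P x}) : ∫ ω, ind (P ω) ∂μ = μ.real {ω | P ω} := by
  rw [← integral_indicator_one h]
  congr 1

/-- The source of orthogonality in both laws of large numbers: a centred variable is integrated
against something independent of it. -/
theorem integral_mul_eq_zero_of_indep {Ω : Type*} {m₁ m₂ mΩ : MeasurableSpace Ω} {μ : Measure Ω}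
    (h₁ : m₁ ≤ mΩ) (h₂ : m₂ ≤ mΩ) (hind : Indep m₁ m₂ μ) {g f : Ω → ℝ} (hg : Measurable[m₁] g)
    (hf : Measurable[m₂] f) (hf0 : ∫ ω, f ω ∂μ = 0) : ∫ ω, g ω * f ω ∂μ = 0 := by
  have hgf : IndepFun g f μ := by
    rw [IndepFun_iff_Indep]
    exact indep_of_indep_of_le_left (indep_of_indep_of_le_right hind hf.comap_le) hg.comap_le
  rw [hgf.integral_fun_mul_eq_mul_integral (hg.mono h₁ le_rfl).aestronglyMeasurable
    (hf.mono h₂ le_rfl).aestronglyMeasurable, hf0, mul_zero]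

namespace MixInput

variable {n : ℕ} [NeZero n] {R : Type*}

/-- The initial contents of the queues and the steps of the first `t` arrivals. -/
noncomputable def hist (x : MixInput n R) (t : ℕ) :
    (Fin n → List R) × (Fin t → Fin n × Finset (Fin n)) :=
  (x.init, fun u => x.step u)

theorem hist_eq_iff {x y : MixInput n R} {t : ℕ} :
    x.hist t = y.hist t ↔ x.init = y.init ∧ ∀ u < t, x.step u = y.step u := by
  simp only [hist, Prod.mk.injEq, funext_iff (f := fun u : Fin t => x.step u), Fin.forall_iff]

theorem hist_eq_of_le {x y : MixInput n R} {s t : ℕ} (hst : s ≤ t) (h : x.hist t = y.hist t) :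
    x.hist s = y.hist s := by
  rw [hist_eq_iff] at h ⊢
  exact ⟨h.1, fun u hu => h.2 u (hu.trans_le hst)⟩

theorem step_eq_of_hist_eq {x y : MixInput n R} {s t : ℕ} (hst : s < t)
    (h : x.hist t = y.hist t) : x.step s = y.step s :=
  (hist_eq_iff.1 h).2 s hst

end MixInput

/-- The probability that the step of an arrival lies in `F`. -/
noncomputable def stepLaw (n k : ℕ) (p : ℝ) (F : Set (Fin n × Finset (Fin n))) : ENNReal :=
  ∑ z, F.indicator (stepWeight n k p) z

namespace SamplingMix

open MixInput

variable {n k : ℕ} {p : ℝ} {R Ω : Type*} [MeasurableSpace Ω] {μ : Measure Ω}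

variable [NeZero n]

/-- The value of the path at `t` is free, so a history and its continuation by one step are path
events of the same path. -/
theorem exists_path_of_hist (t : ℕ) (h : (Fin n → List R) × (Fin t → Fin n × Finset (Fin n)))
    (z : Fin n × Finset (Fin n)) : ∃ z₀ : ℕ → Fin n × Finset (Fin n), z₀ t = z ∧
      ∀ x : MixInput n R, x.hist t = h ↔ x.init = h.1 ∧ ∀ u < t, x.step u = z₀ u := by
  refine ⟨fun u => if hu : u < t then h.2 ⟨u, hu⟩ else z, by simp, fun x => ?_⟩
  rw [hist, Prod.ext_iff]
  refine and_congr Iff.rfl ?_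
  rw [funext_iff, Fin.forall_iff]
  refine forall_congr' fun u => forall_congr' fun hu => ?_
  simp [hu]

theorem measurableSet_hist [Countable R] (X : SamplingMix n k p R μ) (t : ℕ)
    (S : Set ((Fin n → List R) × (Fin t → Fin n × Finset (Fin n)))) :
    MeasurableSet[X.undirected] {ω | (X.input ω).hist t ∈ S} := by
  have hS : {ω | (X.input ω).hist t ∈ S} = ⋃ h ∈ S, {ω | (X.input ω).hist t = h} := by
    ext ω; simp
  rw [hS]
  refine MeasurableSet.biUnion S.to_countable fun h _ => ?_
  obtain ⟨z₀, -, hz₀⟩ := exists_path_of_hist t h (0, ∅)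
  simp_rw [hz₀]
  exact X.past_le_undirected z₀ t _ (X.measurableSet_pathEvent h.1 z₀ t)

/-- A history takes countably many values and omits the addresses, so each property which it
determines is measurable with respect to `undirected`. -/
theorem measurableSet_of_hist [Countable R] (X : SamplingMix n k p R μ) (t : ℕ)
    {N : MixInput n R → Prop} (hN : ∀ x y, x.hist t = y.hist t → N x → N y) :
    MeasurableSet[X.undirected] {ω | N (X.input ω)} := by
  convert! X.measurableSet_hist t {h | ∃ x, x.hist t = h ∧ N x} using 1
  ext ω
  exact ⟨fun h => ⟨_, rfl, h⟩, fun ⟨x, hx, h⟩ => hN _ _ hx h⟩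

theorem measurableSet_step [Countable R] (X : SamplingMix n k p R μ) (t : ℕ)
    (F : Set (Fin n × Finset (Fin n))) :
    MeasurableSet[X.undirected] {ω | (X.input ω).step t ∈ F} :=
  X.measurableSet_of_hist (t + 1) (N := fun x => x.step t ∈ F) fun x y h hx => by
    rwa [← step_eq_of_hist_eq t.lt_succ_self h]

variable [IsProbabilityMeasure μ]

/-- The probabilities of consecutive path events differ exactly by the factor `stepWeight` of the
last step. -/
theorem measure_hist_eq_inter_step [Countable R] (X : SamplingMix n k p R μ) (t : ℕ)
    (h : (Fin n → List R) × (Fin t → Fin n × Finset (Fin n)))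
    (F : Set (Fin n × Finset (Fin n))) :
    μ ({ω | (X.input ω).hist t = h} ∩ {ω | (X.input ω).step t ∈ F})
      = μ {ω | (X.input ω).hist t = h} * stepLaw n k p F := by
  classical
  have hz : ∀ z, μ ({ω | (X.input ω).hist t = h} ∩ {ω | (X.input ω).step t = z})
      = μ {ω | (X.input ω).hist t = h} * stepWeight n k p z := by
    intro z
    obtain ⟨z₀, rfl, hz₀⟩ := exists_path_of_hist t h z
    have h1 : {ω | (X.input ω).hist t = h} = X.pathEvent h.1 z₀ t := by
      ext ω; exact hz₀ _
    have h2 : {ω | (X.input ω).hist t = h} ∩ {ω | (X.input ω).step t = z₀ t}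
        = X.pathEvent h.1 z₀ (t + 1) := by
      rw [h1]
      ext ω
      simp only [pathEvent, Set.mem_inter_iff, Set.mem_ofPred_eq, Nat.lt_succ_iff_lt_or_eq,
        or_imp, forall_and, forall_eq, and_assoc]
    rw [h2, h1, X.measure_pathEvent, X.measure_pathEvent, Finset.prod_range_succ, mul_assoc]
  have hF : {ω | (X.input ω).hist t = h} ∩ {ω | (X.input ω).step t ∈ F}
      = ⋃ z ∈ Finset.univ.filter (· ∈ F),
        {ω | (X.input ω).hist t = h} ∩ {ω | (X.input ω).step t = z} := by
    ext ω; simp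
  have hm1 : MeasurableSet {ω | (X.input ω).hist t = h} :=
    X.undirected_le _ (X.measurableSet_hist t {h})
  rw [hF, measure_biUnion_finset]
  · simp_rw [hz]
    rw [← Finset.mul_sum, stepLaw, Finset.sum_filter]
    simp only [Set.indicator_apply]
  · intro z _ z' _ hne
    refine Set.disjoint_left.2 fun ω h1 h2 => hne ?_
    exact h1.2.symm.trans h2.2
  · exact fun z _ => hm1.inter (X.undirected_le _ (X.measurableSet_step t {z}))

/-- The step of an arrival is independent of the history. -/
theorem measure_hist_inter_step [Countable R] (X : SamplingMix n k p R μ) (t : ℕ)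
    (S : Set ((Fin n → List R) × (Fin t → Fin n × Finset (Fin n))))
    (F : Set (Fin n × Finset (Fin n))) :
    μ ({ω | (X.input ω).hist t ∈ S} ∩ {ω | (X.input ω).step t ∈ F})
      = μ {ω | (X.input ω).hist t ∈ S} * stepLaw n k p F := by
  have hS : {ω | (X.input ω).hist t ∈ S} = ⋃ h ∈ S, {ω | (X.input ω).hist t = h} := by
    ext ω; simp
  have hm : ∀ h, MeasurableSet {ω | (X.input ω).hist t = h} := fun h =>
    X.undirected_le _ (X.measurableSet_hist t {h})
  have hmF := X.undirected_le _ (X.measurableSet_step t F)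
  have hd : S.PairwiseDisjoint fun h => {ω | (X.input ω).hist t = h} := fun h _ h' _ hne =>
    Set.disjoint_left.2 fun ω h1 h2 => hne (h1.symm.trans h2)
  rw [hS, Set.iUnion₂_inter, measure_biUnion S.to_countable hd fun h _ => hm h,
    measure_biUnion S.to_countable _ fun h _ => (hm h).inter hmF]
  · simp_rw [X.measure_hist_eq_inter_step]
    rw [ENNReal.tsum_mul_right]
  · exact fun h hh h' hh' hne =>
      (hd hh hh' hne).mono Set.inter_subset_left Set.inter_subset_left

theorem measure_step [Countable R] (X : SamplingMix n k p R μ) (t : ℕ)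
    (F : Set (Fin n × Finset (Fin n))) :
    μ {ω | (X.input ω).step t ∈ F} = stepLaw n k p F := by
  simpa using X.measure_hist_inter_step t Set.univ F

theorem measure_inter_step [Countable R] (X : SamplingMix n k p R μ) (t : ℕ)
    {N : MixInput n R → Prop} (hN : ∀ x y, x.hist t = y.hist t → N x → N y)
    (F : Set (Fin n × Finset (Fin n))) :
    μ {ω | N (X.input ω) ∧ (X.input ω).step t ∈ F}
      = μ {ω | N (X.input ω)} * stepLaw n k p F := by
  have h : {ω | N (X.input ω)} = {ω | (X.input ω).hist t ∈ {h | ∃ x, x.hist t = h ∧ N x}} := by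
    ext ω
    exact ⟨fun h => ⟨_, rfl, h⟩, fun ⟨x, hx, h⟩ => hN _ _ hx h⟩
  rw [h, ← X.measure_hist_inter_step, ← h]
  rfl

theorem indep_hist_step [Countable R] (X : SamplingMix n k p R μ) (t : ℕ) :
    Indep (MeasurableSpace.comap (fun ω => (X.input ω).hist t) ⊤)
      (MeasurableSpace.comap (fun ω => (X.input ω).step t) ⊤) μ := by
  rw [Indep_iff]
  rintro _ _ ⟨S, -, rfl⟩ ⟨F, -, rfl⟩
  have := X.measure_hist_inter_step t S F
  rw [← X.measure_step] at this
  exact this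

/-- If `N t` depends only on the history before the `t`-th arrival, then the steps of the arrivals
at which `N` holds obey the law of large numbers. -/
theorem ae_tendsto_average_step [Countable R] (X : SamplingMix n k p R μ)
    {N : ℕ → MixInput n R → Prop} (hN : ∀ t x y, x.hist t = y.hist t → N t x → N t y)
    (F : Set (Fin n × Finset (Fin n))) :
    ∀ᵐ ω ∂μ, Tendsto (fun T : ℕ => (∑ t ∈ Finset.range T, ind (N t (X.input ω)) *
      (ind ((X.input ω).step t ∈ F) - (stepLaw n k p F).toReal)) / (T : ℝ)) atTop (𝓝 0) := by
  set c := (stepLaw n k p F).toReal with hc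
  have hN' : ∀ t x y, x.hist t = y.hist t → (N t x ↔ N t y) := fun t x y h =>
    ⟨hN t x y h, hN t y x h.symm⟩
  have hc0 : 0 ≤ c := ENNReal.toReal_nonneg
  have hc1 : c ≤ 1 := by
    rw [hc, ← X.measure_step 0 F]
    exact measureReal_le_one
  have hmN : ∀ t, Measurable fun ω => ind (N t (X.input ω)) := fun t =>
    measurable_ind (X.undirected_le _ (X.measurableSet_of_hist t (hN t)))
  have hmF : ∀ t, Measurable fun ω => ind ((X.input ω).step t ∈ F) := fun t =>
    measurable_ind (X.undirected_le _ (X.measurableSet_step t F))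
  refine ae_tendsto_average_of_orthogonal (C := 1) (fun t => (hmN t).mul ((hmF t).sub_const c))
    (fun t ω => ?_) fun s t hst => ?_
  · rw [abs_mul, abs_of_nonneg (ind_nonneg _)]
    refine mul_le_one₀ (ind_le_one _) (abs_nonneg _) (abs_le.2 ⟨?_, ?_⟩)
    · linarith [ind_nonneg ((X.input ω).step t ∈ F)]
    · linarith [ind_le_one ((X.input ω).step t ∈ F)]
  · simp_rw [← mul_assoc]
    have hle1 : MeasurableSpace.comap (fun ω => (X.input ω).hist t) ⊤ ≤ ‹MeasurableSpace Ω› := by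
      rintro _ ⟨S, -, rfl⟩
      exact X.undirected_le _ (X.measurableSet_hist t S)
    have hle2 : MeasurableSpace.comap (fun ω => (X.input ω).step t) ⊤ ≤ ‹MeasurableSpace Ω› := by
      rintro _ ⟨S, -, rfl⟩
      exact X.undirected_le _ (X.measurableSet_step t S)
    refine integral_mul_eq_zero_of_indep hle1 hle2 (X.indep_hist_step t) ?_ ?_ ?_
    -- As `s < t`, every factor except the centred step at `t` is a function of the history before
    -- `t`.
    · set g : MixInput n R → ℝ := fun x => ind (N s x) * (ind (x.step s ∈ F) - c) * ind (N t x)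
      have hfac : g.FactorsThrough fun x => x.hist t := fun x y h => by
        simp only [g]
        rw [ind_congr (hN' s x y (hist_eq_of_le hst.le h)), ind_congr (hN' t x y h),
          step_eq_of_hist_eq hst h]
      obtain ⟨e, he⟩ := (Function.factorsThrough_iff g).1 hfac
      have : (fun ω => g (X.input ω)) = e ∘ fun ω => (X.input ω).hist t := by rw [he]; rfl
      change Measurable[MeasurableSpace.comap (fun ω => (X.input ω).hist t) ⊤]
        (fun ω => g (X.input ω))
      rw [this]
      exact measurable_from_top.comp (comap_measurable _)
    · exact (measurable_from_top (f := fun z => ind (z ∈ F) - c)).comp (comap_measurable _)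
    · rw [integral_sub, integral_ind (X.undirected_le _ (X.measurableSet_step t F))]
      · simp [Measure.real, X.measure_step, hc]
      · exact Integrable.of_bound (hmF t).aestronglyMeasurable 1 (ae_of_all _ fun ω => by
          rw [Real.norm_eq_abs, abs_of_nonneg (ind_nonneg _)]; exact ind_le_one _)
      · exact integrable_const _

end SamplingMix

/-! ### Release probabilities by counting `k`-subsets. -/

section Counting

/-- Removing `I` from `A` leaves an arbitrary subset of the complement of `I ∪ E`, of size `k -
I.card`. -/
theorem card_filter_card_eq_of_subset_of_disjoint {n k : ℕ} {I E : Finset (Fin n)}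
    (hIE : Disjoint I E) (hk : I.card ≤ k) :
    (Finset.univ.filter fun A : Finset (Fin n) => A.card = k ∧ I ⊆ A ∧ Disjoint E A).card
      = (n - I.card - E.card).choose (k - I.card) := by
  have hcard : (I ∪ E)ᶜ.card = n - I.card - E.card := by
    rw [Finset.card_compl, Finset.card_union_of_disjoint hIE, Fintype.card_fin, Nat.sub_sub]
  rw [← hcard, ← Finset.card_powersetCard]
  refine Finset.card_bij' (fun A _ => A \ I) (fun B _ => B ∪ I) ?_ ?_ ?_ ?_
  · intro A hA
    simp only [Finset.mem_filter, Finset.mem_univ, true_and] at hA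
    rw [Finset.mem_powersetCard]
    refine ⟨fun x hx => ?_, by rw [Finset.card_sdiff_of_subset hA.2.1, hA.1]⟩
    rw [Finset.mem_sdiff] at hx
    simp only [Finset.mem_compl, Finset.mem_union, not_or]
    exact ⟨hx.2, fun h => Finset.disjoint_left.1 hA.2.2 h hx.1⟩
  · intro B hB
    rw [Finset.mem_powersetCard] at hB
    simp only [Finset.mem_filter, Finset.mem_univ, true_and]
    have hBI : Disjoint B I := Finset.disjoint_left.2 fun x hx hxI => by
      have := hB.1 hx
      simp [hxI] at this
    refine ⟨by rw [Finset.card_union_of_disjoint hBI, hB.2]; omega, Finset.subset_union_right, ?_⟩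
    rw [Finset.disjoint_union_right]
    refine ⟨Finset.disjoint_left.2 fun x hx hxB => ?_, hIE.symm⟩
    have := hB.1 hxB
    simp [hx] at this
  · intro A hA
    simp only [Finset.mem_filter, Finset.mem_univ, true_and] at hA
    exact Finset.sdiff_union_of_subset hA.2.1
  · intro B hB
    rw [Finset.mem_powersetCard] at hB
    have hBI : Disjoint B I := Finset.disjoint_left.2 fun x hx hxI => by
      have := hB.1 hx
      simp [hxI] at this
    exact Finset.union_sdiff_cancel_right hBI

end Counting

section ReleaseProb

theorem sum_releaseProb {n k : ℕ} (p : ℝ) (s : Fin n) (Q : Finset (Fin n) → Prop)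
    [DecidablePred Q] :
    ∑ A, ind (Q A) * releaseProb n k p s A
      = (Finset.univ.filter fun A : Finset (Fin n) => A.card = k ∧ s ∈ A ∧ Q A).card
          * (p / ((n - 1).choose (k - 1) : ℝ))
        + (Finset.univ.filter fun A : Finset (Fin n) => A.card = k ∧ s ∉ A ∧ Q A).card
          * ((1 - p) / ((n - 1).choose k : ℝ)) := by
  rw [← nsmul_eq_mul, ← nsmul_eq_mul, ← Finset.sum_const, ← Finset.sum_const, Finset.sum_filter,
    Finset.sum_filter, ← Finset.sum_add_distrib]
  refine Finset.sum_congr rfl fun A _ => ?_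
  unfold releaseProb
  by_cases h1 : Q A <;> by_cases h2 : A.card = k <;> by_cases h3 : s ∈ A <;> simp [ind, h1, h2, h3]

variable {n k : ℕ} {p : ℝ}

theorem releaseProb_nonneg (hp0 : 0 ≤ p) (hp1 : p ≤ 1) (s : Fin n) (A : Finset (Fin n)) :
    0 ≤ releaseProb n k p s A := by
  unfold releaseProb
  have : 0 ≤ 1 - p := by linarith
  split_ifs <;> positivity

theorem sum_releaseProb_self (hk : 2 ≤ k) (hkn : k ≤ n) (s : Fin n) :
    ∑ A, ind (s ∈ A) * releaseProb n k p s A = p := by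
  rw [sum_releaseProb]
  have h1 : (Finset.univ.filter fun A : Finset (Fin n) => A.card = k ∧ s ∈ A ∧ s ∈ A).card
      = (n - 1).choose (k - 1) := by
    rw [← Finset.card_singleton s,
      ← Nat.sub_zero (n - _), ← Finset.card_empty (α := Fin n),
      ← card_filter_card_eq_of_subset_of_disjoint (by simp) (by simp; omega)]
    congr 1
    ext A
    simp
  have h2 : (Finset.univ.filter fun A : Finset (Fin n) => A.card = k ∧ s ∉ A ∧ s ∈ A) = ∅ := by
    ext A; simp
  have h3 : ((n - 1).choose (k - 1) : ℝ) ≠ 0 := by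
    exact_mod_cast (Nat.choose_pos (by omega)).ne'
  rw [h1, h2, Finset.card_empty, Nat.cast_zero, zero_mul, add_zero, mul_div_cancel₀ _ h3]

theorem sum_releaseProb_univ (hk : 2 ≤ k) (hkn : k ≤ n) (hkp : k = n → p = 1) (s : Fin n) :
    ∑ A, releaseProb n k p s A = 1 := by
  have h0 := sum_releaseProb (k := k) p s fun A => s ∉ A
  have h1 : (Finset.univ.filter fun A : Finset (Fin n) => A.card = k ∧ s ∉ A ∧ s ∉ A).card
      = (n - 1).choose k := by
    have := card_filter_card_eq_of_subset_of_disjoint (n := n) (k := k) (I := ∅) (E := {s})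
      (by simp) (by simp)
    rw [Finset.card_singleton, Finset.card_empty] at this
    rw [Nat.sub_zero, Nat.sub_zero] at this
    rw [← this]
    congr 1
    ext A
    simp
  have h2 : (Finset.univ.filter fun A : Finset (Fin n) => A.card = k ∧ s ∈ A ∧ s ∉ A) = ∅ := by
    ext A; simp
  rw [h1, h2, Finset.card_empty, Nat.cast_zero, zero_mul, zero_add] at h0
  have h3 : ((n - 1).choose k : ℝ) * ((1 - p) / ((n - 1).choose k : ℝ)) = 1 - p := by
    -- For `k = n` the binomial coefficient is zero and cannot be cancelled, but then `1 - p`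
    -- vanishes as well.
    rcases hkn.eq_or_lt with h | h
    · rw [hkp h]; simp
    · have : ((n - 1).choose k : ℝ) ≠ 0 := by
        exact_mod_cast (Nat.choose_pos (by omega)).ne'
      rw [mul_div_cancel₀ _ this]
  rw [h3] at h0
  have h4 := sum_releaseProb_self (p := p) hk hkn s
  have h5 : ∑ A, releaseProb n k p s A = ∑ A, ind (s ∈ A) * releaseProb n k p s A
      + ∑ A, ind (s ∉ A) * releaseProb n k p s A := by
    rw [← Finset.sum_add_distrib]
    refine Finset.sum_congr rfl fun A _ => ?_
    by_cases h : s ∈ A <;> simp [ind, h]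
  rw [h5, h4, h0]
  ring

/-- Queue `j` is among the `k - 1` or the `k` random ones out of `n - 1`, so the value is `p * (k -
1) / (n - 1) + (1 - p) * k / (n - 1)`. -/
theorem sum_releaseProb_other (hk : 2 ≤ k) (hkn : k ≤ n) (hkp : k = n → p = 1) {s j : Fin n}
    (hj : j ≠ s) :
    ∑ A, ind (j ∈ A) * releaseProb n k p s A = (k - p) / ((n : ℝ) - 1) := by
  rw [sum_releaseProb]
  have h1 : (Finset.univ.filter fun A : Finset (Fin n) => A.card = k ∧ s ∈ A ∧ j ∈ A).card
      = (n - 2).choose (k - 2) := by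
    have := card_filter_card_eq_of_subset_of_disjoint (n := n) (k := k) (I := {s, j}) (E := ∅)
      (by simp) (by rw [Finset.card_pair hj.symm]; exact hk)
    rw [Finset.card_pair hj.symm, Finset.card_empty, Nat.sub_zero] at this
    rw [← this]
    congr 1
    ext A
    simp [Finset.insert_subset_iff]
  have h2 : (Finset.univ.filter fun A : Finset (Fin n) => A.card = k ∧ s ∉ A ∧ j ∈ A).card
      = (n - 2).choose (k - 1) := by
    have := card_filter_card_eq_of_subset_of_disjoint (n := n) (k := k) (I := {j}) (E := {s})
      (by simpa using hj) (by simp; omega)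
    rw [Finset.card_singleton, Finset.card_singleton, Nat.sub_sub] at this
    rw [← this]
    congr 1
    ext A
    simp [and_comm]
  rw [h1, h2]
  obtain ⟨m, rfl⟩ : ∃ m, n = m + 2 := ⟨n - 2, by omega⟩
  obtain ⟨l, rfl⟩ : ∃ l, k = l + 2 := ⟨k - 2, by omega⟩
  have e1 : ((m + 1 : ℕ) : ℝ) * (m.choose l : ℝ) = ((m + 1).choose (l + 1) : ℝ) * ((l + 1 : ℕ) : ℝ) :=
    mod_cast Nat.add_one_mul_choose_eq m l
  have e2 : ((m + 1 : ℕ) : ℝ) * (m.choose (l + 1) : ℝ)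
      = ((m + 1).choose (l + 2) : ℝ) * ((l + 2 : ℕ) : ℝ) :=
    mod_cast Nat.add_one_mul_choose_eq m (l + 1)
  have c1 : ((m + 1).choose (l + 1) : ℝ) ≠ 0 := by
    exact_mod_cast (Nat.choose_pos (by omega)).ne'
  have hm : (m : ℝ) + 1 ≠ 0 := by positivity
  simp only [show m + 2 - 2 = m by omega, show m + 2 - 1 = m + 1 by omega,
    show l + 2 - 2 = l by omega, show l + 2 - 1 = l + 1 by omega]
  have t1 : (m.choose l : ℝ) * (p / ((m + 1).choose (l + 1) : ℝ)) = p * (l + 1) / (m + 1) := by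
    push_cast at e1
    field_simp
    linear_combination p * e1
  have t2 : (m.choose (l + 1) : ℝ) * ((1 - p) / ((m + 1).choose (l + 2) : ℝ))
      = (1 - p) * (l + 2) / (m + 1) := by
    rcases hkn.eq_or_lt with h | h
    · rw [hkp h]; simp
    · have c2 : ((m + 1).choose (l + 2) : ℝ) ≠ 0 := by
        exact_mod_cast (Nat.choose_pos (by omega)).ne'
      push_cast at e2
      field_simp
      linear_combination (1 - p) * e2
  rw [t1, t2]
  push_cast
  rw [show (m : ℝ) + 2 - 1 = m + 1 by ring]
  field_simp
  ring

end ReleaseProb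

section StepLaw

variable {n k : ℕ} {p : ℝ}

theorem toReal_stepLaw (hp0 : 0 ≤ p) (hp1 : p ≤ 1) (F : Set (Fin n × Finset (Fin n))) :
    (stepLaw n k p F).toReal
      = ∑ s, ∑ A, ind ((s, A) ∈ F) * ((n : ℝ)⁻¹ * releaseProb n k p s A) := by
  rcases Nat.eq_zero_or_pos n with rfl | hn
  · simp [stepLaw]
  rw [stepLaw, ENNReal.toReal_sum, Fintype.sum_prod_type]
  · refine Finset.sum_congr rfl fun s _ => Finset.sum_congr rfl fun A _ => ?_
    by_cases h : (s, A) ∈ F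
    · rw [Set.indicator_of_mem h, ind_of_true h, one_mul, stepWeight, ENNReal.toReal_mul, ENNReal.toReal_inv, ENNReal.toReal_natCast,
        ENNReal.toReal_ofReal (releaseProb_nonneg hp0 hp1 _ _)]
    · rw [Set.indicator_of_notMem h, ind_of_false h, zero_mul, ENNReal.toReal_zero]
  · intro z _
    by_cases h : z ∈ F
    · rw [Set.indicator_of_mem h]
      exact ENNReal.mul_ne_top (by simp [hn.ne']) ENNReal.ofReal_ne_top
    · simp [Set.indicator_of_notMem h]

theorem toReal_stepLaw_sender (hp0 : 0 ≤ p) (hp1 : p ≤ 1) (a : Fin n)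
    (Q : Finset (Fin n) → Prop) :
    (stepLaw n k p {z | z.1 = a ∧ Q z.2}).toReal
      = (n : ℝ)⁻¹ * ∑ A, ind (Q A) * releaseProb n k p a A := by
  rw [toReal_stepLaw hp0 hp1, Finset.sum_eq_single a]
  · rw [Finset.mul_sum]
    refine Finset.sum_congr rfl fun A _ => ?_
    simp only [Set.mem_ofPred_eq, true_and]
    ring
  · intro s _ hs
    simp [ind, hs]
  · simp

theorem toReal_stepLaw_sender_eq (hp0 : 0 ≤ p) (hp1 : p ≤ 1) (hk : 2 ≤ k) (hkn : k ≤ n)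
    (hkp : k = n → p = 1) (a : Fin n) : (stepLaw n k p {z | z.1 = a}).toReal = (n : ℝ)⁻¹ := by
  have := toReal_stepLaw_sender (k := k) hp0 hp1 a fun _ => True
  simpa [ind, sum_releaseProb_univ hk hkn hkp] using this

theorem toReal_stepLaw_sender_self (hp0 : 0 ≤ p) (hp1 : p ≤ 1) (hk : 2 ≤ k) (hkn : k ≤ n)
    (a : Fin n) : (stepLaw n k p {z | z.1 = a ∧ a ∈ z.2}).toReal = (n : ℝ)⁻¹ * p := by
  rw [toReal_stepLaw_sender hp0 hp1 a fun A => a ∈ A, sum_releaseProb_self hk hkn]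

theorem toReal_stepLaw_sender_other (hp0 : 0 ≤ p) (hp1 : p ≤ 1) (hk : 2 ≤ k) (hkn : k ≤ n)
    (hkp : k = n → p = 1) {a j : Fin n} (hj : j ≠ a) :
    (stepLaw n k p {z | z.1 = a ∧ j ∈ z.2}).toReal
      = (n : ℝ)⁻¹ * ((k - p) / ((n : ℝ) - 1)) := by
  rw [toReal_stepLaw_sender hp0 hp1 a fun A => j ∈ A, sum_releaseProb_other hk hkn hkp hj]

/-- Summing over senders, `j` itself contributes `p / n` and the `n - 1` others together contribute
`(k - p) / n`. -/
theorem toReal_stepLaw_released (hp0 : 0 ≤ p) (hp1 : p ≤ 1) (hk : 2 ≤ k) (hkn : k ≤ n)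
    (hkp : k = n → p = 1) (j : Fin n) :
    (stepLaw n k p {z | j ∈ z.2}).toReal = (n : ℝ)⁻¹ * k := by
  classical
  have hn : (n : ℝ) - 1 ≠ 0 := by
    have : (2 : ℝ) ≤ n := by exact_mod_cast hk.trans hkn
    linarith
  have h : (stepLaw n k p {z | j ∈ z.2}).toReal
      = ∑ a, (stepLaw n k p {z | z.1 = a ∧ j ∈ z.2}).toReal := by
    simp_rw [toReal_stepLaw_sender hp0 hp1 _ fun A => j ∈ A]
    rw [toReal_stepLaw hp0 hp1]
    simp only [Finset.mul_sum, Set.mem_ofPred_eq]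
    exact Finset.sum_congr rfl fun a _ => Finset.sum_congr rfl fun A _ => by ring
  rw [h, ← Finset.add_sum_erase _ _ (Finset.mem_univ j), toReal_stepLaw_sender_self hp0 hp1 hk hkn,
    Finset.sum_congr rfl fun a ha =>
      toReal_stepLaw_sender_other hp0 hp1 hk hkn hkp (Finset.ne_of_mem_erase ha).symm,
    Finset.sum_const, Finset.card_erase_of_mem (Finset.mem_univ j), Finset.card_univ,
    Fintype.card_fin, nsmul_eq_mul, Nat.cast_sub (by omega)]
  field_simp
  push_cast
  ring

end StepLaw

/-! ### Sublinear growth of a reflected walk. -/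

/-- A reflected random walk without positive drift grows sublinearly. -/
theorem tendsto_reflected_walk_div {x ξ : ℕ → ℝ} {c : ℝ} (hc : 0 ≤ c) (hx0 : 0 ≤ x 0)
    (hx : ∀ t, x (t + 1) = max (x t + ξ t) 0)
    (hξ : Tendsto (fun T : ℕ => (∑ t ∈ Finset.range T, ξ t) / (T : ℝ)) atTop (𝓝 (-c))) :
    Tendsto (fun T : ℕ => x T / (T : ℝ)) atTop (𝓝 0) := by
  have hnn : ∀ t, 0 ≤ x t := by
    intro t
    cases t with
    | zero => exact hx0
    | succ t => rw [hx]; exact le_max_right _ _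
  set S : ℕ → ℝ := fun T => ∑ t ∈ Finset.range T, ξ t with hS
  have hSs : ∀ t, S (t + 1) = S t + ξ t := fun t => Finset.sum_range_succ _ _
  rw [Metric.tendsto_atTop]
  intro ε hε
  obtain ⟨T₀, hT₀⟩ := Metric.tendsto_atTop.1 hξ (ε / 4) (by positivity)
  have hSb : ∀ T, T₀ ≤ T → 1 ≤ T → |S T + c * T| ≤ ε / 4 * T := by
    intro T hT h1
    have hT0 : (0 : ℝ) < T := by exact_mod_cast h1
    have := hT₀ T hT
    rw [Real.dist_eq, sub_neg_eq_add, div_add' _ _ _ hT0.ne', abs_div, abs_of_pos hT0,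
      div_lt_iff₀ hT0] at this
    exact this.le
  set M : ℝ := max (x (T₀ + 1) - S (T₀ + 1)) 0
  have hM : 0 ≤ M := le_max_right _ _
  -- The difference `x - S` does not change as long as the walk is not reflected. At a reflection
  -- `x` is zero and the difference is `-S`, which is at most `(c + ε / 4) T`. Adding back `S ≤ (-c
  -- + ε / 4) T` bounds `x` by `M + ε / 2 * T`.
  have hy : ∀ d : ℕ, x (T₀ + 1 + d) - S (T₀ + 1 + d)
      ≤ M + (c + ε / 4) * ((T₀ + 1 + d : ℕ) : ℝ) := by
    intro d
    induction d with
    | zero =>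
      have : 0 ≤ (c + ε / 4) * ((T₀ + 1 : ℕ) : ℝ) := by positivity
      have := le_max_left (x (T₀ + 1) - S (T₀ + 1)) 0
      simp only [add_zero]
      linarith
    | succ d ih =>
      rw [← add_assoc, hx, hSs]
      rcases max_cases (x (T₀ + 1 + d) + ξ (T₀ + 1 + d)) 0 with ⟨h, -⟩ | ⟨h, -⟩
      · rw [h]
        push_cast at ih ⊢
        nlinarith
      · rw [h, ← hSs]
        have := neg_le_of_abs_le (hSb (T₀ + 1 + d + 1) (by omega) (by omega))
        nlinarith
  -- From `T₁` on, `M` is below `ε / 4 * T`.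
  obtain ⟨T₁, hT₁⟩ := exists_nat_gt (4 * M / ε)
  refine ⟨max (T₀ + 1) T₁, fun T hT => ?_⟩
  have hT0 : T₀ + 1 ≤ T := le_trans (le_max_left _ _) hT
  have hTM : 4 * M / ε < T := hT₁.trans_le (by exact_mod_cast le_trans (le_max_right _ _) hT)
  have hTpos : (0 : ℝ) < T := by exact_mod_cast (by omega : 0 < T)
  obtain ⟨d, rfl⟩ := Nat.exists_eq_add_of_le hT0
  have h1 := hy d
  have h2 := le_of_abs_le (hSb (T₀ + 1 + d) (by omega) (by omega))
  rw [Real.dist_eq, sub_zero, abs_of_nonneg (div_nonneg (hnn _) hTpos.le), div_lt_iff₀ hTpos]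
  rw [div_lt_iff₀ hε] at hTM
  nlinarith

/-! ### Dynamics of the FIFO queues. -/

namespace MixInput

variable {n : ℕ} [NeZero n] {R : Type*}

/-- A message departs from queue `j` upon the `t`-th arrival. -/
def Departs (x : MixInput n R) (t : ℕ) (j : Fin n) : Prop :=
  j ∈ x.released t ∧ x.enqueue t (x.buffer t) j ≠ []

open Classical in
/-- The number of departures from queue `j` before the `t`-th arrival. -/
noncomputable def departed (x : MixInput n R) (t : ℕ) (j : Fin n) : ℕ :=
  ∑ u ∈ Finset.range t, if x.Departs u j then 1 else 0

/-- All messages which have been in queue `j` before the `t`-th arrival, in their order. -/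
noncomputable def messages (x : MixInput n R) (t : ℕ) (j : Fin n) : List R :=
  x.init j ++ (List.range (x.sent t j)).map (x.dest j)

theorem departs_iff_exists_forwards (x : MixInput n R) (t : ℕ) (j : Fin n) :
    x.Departs t j ↔ ∃ r, x.Forwards t j r := by
  simp only [Departs, Forwards, exists_and_left]
  refine and_congr_right fun _ => ?_
  cases x.enqueue t (x.buffer t) j <;> simp

theorem departed_succ_of_departs {x : MixInput n R} {t : ℕ} {j : Fin n} (h : x.Departs t j) :
    x.departed (t + 1) j = x.departed t j + 1 := by
  rw [departed, Finset.sum_range_succ, if_pos h]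
  rfl

theorem departed_succ_of_not_departs {x : MixInput n R} {t : ℕ} {j : Fin n}
    (h : ¬ x.Departs t j) : x.departed (t + 1) j = x.departed t j := by
  rw [departed, Finset.sum_range_succ, if_neg h]
  rfl

theorem departed_mono (x : MixInput n R) (j : Fin n) : Monotone fun t => x.departed t j :=
  monotone_nat_of_le_succ fun t => by
    by_cases h : x.Departs t j
    · rw [departed_succ_of_departs h]; exact Nat.le_succ _
    · rw [departed_succ_of_not_departs h]

theorem cast_departed (x : MixInput n R) (t : ℕ) (j : Fin n) :
    (x.departed t j : ℝ) = ∑ u ∈ Finset.range t, ind (x.Departs u j) := by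
  simp [departed, ind]

theorem cast_sent (x : MixInput n R) (t : ℕ) (j : Fin n) :
    (x.sent t j : ℝ) = ∑ u ∈ Finset.range t, ind (x.sender u = j) := by
  induction t with
  | zero => simp [sent]
  | succ t ih =>
    rw [Finset.sum_range_succ, ← ih, sent_succ, Function.update_apply]
    by_cases h : j = x.sender t
    · rw [if_pos h, ind_of_true h.symm, h]
      push_cast
      rfl
    · rw [if_neg h, ind_of_false (Ne.symm h), add_zero]

theorem sent_le (x : MixInput n R) (t : ℕ) (j : Fin n) : x.sent t j ≤ t := by
  have h : (x.sent t j : ℝ) ≤ t := by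
    rw [cast_sent]
    simpa using Finset.sum_le_card_nsmul (Finset.range t) (fun u => ind (x.sender u = j)) 1
      fun u _ => ind_le_one _
  exact_mod_cast h

theorem messages_succ (x : MixInput n R) (t : ℕ) (j : Fin n) :
    x.messages (t + 1) j = x.messages t j ++ if x.sender t = j then [x.dest j (x.sent t j)]
      else [] := by
  rw [messages, sent_succ, Function.update_apply]
  by_cases h : j = x.sender t
  · rw [if_pos h, if_pos h.symm, ← h, List.range_succ, List.map_append, ← List.append_assoc]
    rfl
  · rw [if_neg h, if_neg (Ne.symm h), List.append_nil]
    rfl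

theorem length_messages (x : MixInput n R) (t : ℕ) (j : Fin n) :
    (x.messages t j).length = (x.init j).length + x.sent t j := by
  simp [messages]

theorem enqueue_apply (x : MixInput n R) (t : ℕ) (b : Fin n → List R) (j : Fin n) :
    x.enqueue t b j = b j ++ if x.sender t = j then [x.dest j (x.sent t j)] else [] := by
  rw [enqueue, Function.update_apply]
  by_cases h : j = x.sender t
  · rw [if_pos h, if_pos h.symm, h]
  · rw [if_neg h, if_neg (Ne.symm h), List.append_nil]

theorem enqueue_eq_drop_of_buffer {x : MixInput n R} {t : ℕ} {j : Fin n}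
    (h : x.departed t j ≤ (x.messages t j).length ∧
      x.buffer t j = (x.messages t j).drop (x.departed t j)) :
    x.enqueue t (x.buffer t) j = (x.messages (t + 1) j).drop (x.departed t j) := by
  rw [enqueue_apply, messages_succ, h.2, List.drop_append_of_le_length h.1]

/-- The queues are FIFO. -/
theorem buffer_eq_drop (x : MixInput n R) (t : ℕ) (j : Fin n) :
    x.departed t j ≤ (x.messages t j).length ∧
      x.buffer t j = (x.messages t j).drop (x.departed t j) := by
  induction t with
  | zero => simp [departed, messages, buffer, sent]
  | succ t ih =>
    have he := enqueue_eq_drop_of_buffer ih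
    have hlen : (x.messages t j).length ≤ (x.messages (t + 1) j).length := by
      rw [messages_succ, List.length_append]
      exact Nat.le_add_right _ _
    have hb : x.buffer (t + 1) j = if j ∈ x.released t then
        (x.enqueue t (x.buffer t) j).tail else x.enqueue t (x.buffer t) j := rfl
    by_cases hd : x.Departs t j
    · rw [departed_succ_of_departs hd, hb, if_pos hd.1, he, List.tail_drop]
      refine ⟨?_, rfl⟩
      have := hd.2
      rw [he, Ne, List.drop_eq_nil_iff, not_le] at this
      exact this
    · rw [departed_succ_of_not_departs hd]
      refine ⟨ih.1.trans hlen, ?_⟩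
      rw [hb, ← he]
      split_ifs with hj
      · have : x.enqueue t (x.buffer t) j = [] := by
          by_contra hne
          exact hd ⟨hj, hne⟩
        rw [this, List.tail_nil]
      · rfl

theorem enqueue_buffer_eq_drop (x : MixInput n R) (t : ℕ) (j : Fin n) :
    x.enqueue t (x.buffer t) j = (x.messages (t + 1) j).drop (x.departed t j) :=
  enqueue_eq_drop_of_buffer (x.buffer_eq_drop t j)

theorem departs_iff (x : MixInput n R) (t : ℕ) (j : Fin n) :
    x.Departs t j ↔ j ∈ x.released t ∧
      x.departed t j < (x.init j).length + x.sent (t + 1) j := by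
  rw [Departs, enqueue_buffer_eq_drop, Ne, List.drop_eq_nil_iff, not_le, length_messages]

theorem forwards_iff (x : MixInput n R) (t : ℕ) (j : Fin n) (r : R) :
    x.Forwards t j r ↔ j ∈ x.released t ∧
      (x.messages (t + 1) j)[x.departed t j]? = some r := by
  rw [Forwards, enqueue_buffer_eq_drop, List.head?_drop]

theorem length_buffer_add_departed (x : MixInput n R) (t : ℕ) (j : Fin n) :
    (x.buffer t j).length + x.departed t j = (x.init j).length + x.sent t j := by
  have h := x.buffer_eq_drop t j
  rw [h.2, List.length_drop, ← length_messages, Nat.sub_add_cancel h.1]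

/-- The reflection at zero expresses that the release of an empty queue has no effect (`tail` of
`[]` is `[]`). -/
theorem length_buffer_succ (x : MixInput n R) (t : ℕ) (j : Fin n) :
    ((x.buffer (t + 1) j).length : ℝ) = max (((x.buffer t j).length : ℝ)
      + (ind (x.sender t = j) - ind (j ∈ x.released t))) 0 := by
  have hb : x.buffer (t + 1) j = if j ∈ x.released t then
      (x.enqueue t (x.buffer t) j).tail else x.enqueue t (x.buffer t) j := rfl
  have hlen : ((x.enqueue t (x.buffer t) j).length : ℝ)
      = (x.buffer t j).length + ind (x.sender t = j) := by
    rw [enqueue_apply]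
    by_cases h : x.sender t = j <;> simp [ind, h]
  rw [hb, ← add_sub_assoc, ← hlen]
  by_cases hj : j ∈ x.released t
  · rw [if_pos hj, ind_of_true hj, List.length_tail]
    cases x.enqueue t (x.buffer t) j <;> simp
  · rw [if_neg hj, ind_of_false hj]
    simp

/-- The arriving message joins before the release, so the queue of the sender is never empty then.
-/
theorem departs_iff_of_sender_eq {x : MixInput n R} {t : ℕ} {j : Fin n} (h : x.sender t = j) :
    x.Departs t j ↔ j ∈ x.released t := by
  simp [Departs, enqueue_apply, h]

theorem departs_iff_of_sender_ne {x : MixInput n R} {t : ℕ} {j : Fin n} (h : x.sender t ≠ j) :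
    x.Departs t j ↔ x.buffer t j ≠ [] ∧ j ∈ x.released t := by
  simp [Departs, enqueue_apply, h, and_comm]

theorem sent_eq_of_hist_eq {x y : MixInput n R} {t : ℕ} (h : x.hist t = y.hist t) :
    x.sent t = y.sent t := by
  rw [x.sent_eq_pathSent (z := y.step) fun u hu => step_eq_of_hist_eq hu h,
    y.sent_eq_pathSent (z := y.step) fun u hu => rfl]

/-- By `departs_iff` departures are decided by counters alone: initial length, messages sent,
release sets. Addresses play no role, which is what later makes them independent of the departure
times. -/
theorem departed_eq_of_hist_eq {x y : MixInput n R} {t : ℕ} (h : x.hist t = y.hist t)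
    (j : Fin n) : x.departed t j = y.departed t j := by
  induction t with
  | zero => simp [departed]
  | succ t ih =>
    have ih := ih (hist_eq_of_le t.le_succ h)
    have hd : x.Departs t j ↔ y.Departs t j := by
      have hr : x.released t = y.released t :=
        congrArg Prod.snd (step_eq_of_hist_eq t.lt_succ_self h)
      rw [departs_iff, departs_iff, ih, sent_eq_of_hist_eq h, (hist_eq_iff.1 h).1, hr]
    by_cases hx : x.Departs t j
    · rw [departed_succ_of_departs hx, departed_succ_of_departs (hd.1 hx), ih]
    · rw [departed_succ_of_not_departs hx, departed_succ_of_not_departs (mt hd.2 hx), ih]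

theorem length_buffer_eq_of_hist_eq {x y : MixInput n R} {t : ℕ} (h : x.hist t = y.hist t)
    (j : Fin n) : (x.buffer t j).length = (y.buffer t j).length := by
  have hx := x.length_buffer_add_departed t j
  have hy := y.length_buffer_add_departed t j
  rw [departed_eq_of_hist_eq h, sent_eq_of_hist_eq h, (hist_eq_iff.1 h).1] at hx
  omega

theorem buffer_ne_nil_of_hist_eq {t : ℕ} {j : Fin n} (x y : MixInput n R)
    (h : x.hist t = y.hist t) (hx : x.buffer t j ≠ []) : y.buffer t j ≠ [] := by
  rw [← List.length_pos_iff] at hx ⊢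
  rwa [← length_buffer_eq_of_hist_eq h]

/-- Upon the `t`-th arrival, which is from `a`, the `m`-th message of sender `j` departs. -/
def DepartsAs (x : MixInput n R) (a j : Fin n) (t m : ℕ) : Prop :=
  x.sender t = a ∧ j ∈ x.released t ∧ x.departed t j = (x.init j).length + m ∧
    m < x.sent (t + 1) j

theorem departsAs_of_hist_eq {a j : Fin n} {t m : ℕ} (x y : MixInput n R)
    (h : x.hist (t + 1) = y.hist (t + 1)) (hx : x.DepartsAs a j t m) : y.DepartsAs a j t m := by
  have hs := step_eq_of_hist_eq t.lt_succ_self h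
  have hs1 : x.sender t = y.sender t := congrArg Prod.fst hs
  have hs2 : x.released t = y.released t := congrArg Prod.snd hs
  rwa [DepartsAs, ← hs1, ← hs2, ← departed_eq_of_hist_eq (hist_eq_of_le t.le_succ h),
    ← (hist_eq_iff.1 h).1, ← sent_eq_of_hist_eq h]

theorem DepartsAs.departs {x : MixInput n R} {a j : Fin n} {t m : ℕ}
    (h : x.DepartsAs a j t m) : x.Departs t j :=
  (x.departs_iff t j).2 ⟨h.2.1, by rw [h.2.2.1]; exact Nat.add_lt_add_left h.2.2.2 _⟩

/-- No message departs twice. -/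
theorem DepartsAs.not_of_lt {x : MixInput n R} {a j : Fin n} {s t m : ℕ} (hst : s < t)
    (hs : x.DepartsAs a j s m) : ¬ x.DepartsAs a j t m := fun ht => by
  have h1 := departed_succ_of_departs hs.departs
  have h2 := x.departed_mono j (Nat.succ_le_of_lt hst)
  simp only [Nat.succ_eq_add_one] at h2
  have h3 := hs.2.2.1
  have h4 := ht.2.2.1
  omega

theorem DepartsAs.eq {x : MixInput n R} {a j : Fin n} {t m m' : ℕ}
    (h : x.DepartsAs a j t m) (h' : x.DepartsAs a j t m') : m = m' := by
  have h3 := h.2.2.1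
  have h4 := h'.2.2.1
  omega

/-- Departures to `r` upon arrivals from `a` differ from their predictable part only by departures
of messages which have been in the mix initially. -/
theorem abs_ind_forwards_sub_le (x : MixInput n R) (a j : Fin n) (r : R) (t : ℕ) {c : ℝ}
    (hc0 : 0 ≤ c) (hc1 : c ≤ 1) :
    |ind (x.sender t = a ∧ x.Forwards t j r) - c * ind (x.sender t = a ∧ x.Departs t j)
        - ∑ m ∈ Finset.range (t + 1), ind (x.DepartsAs a j t m) * (ind (x.dest j m = r) - c)|
      ≤ ind (x.Departs t j ∧ x.departed t j < (x.init j).length) := by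
  by_cases hd : x.sender t = a ∧ x.Departs t j
  · by_cases hi : x.departed t j < (x.init j).length
    · have hdi : x.Departs t j ∧ x.departed t j < (x.init j).length := ⟨hd.2, hi⟩
      rw [ind_of_true hd, ind_of_true hdi, Finset.sum_eq_zero]
      · rw [abs_le]
        constructor <;> linarith [ind_nonneg (x.sender t = a ∧ x.Forwards t j r),
          ind_le_one (x.sender t = a ∧ x.Forwards t j r)]
      · intro m _
        rw [ind_of_false, zero_mul]
        intro h
        have := h.2.2.1
        omega
    · obtain ⟨m, hm⟩ := Nat.exists_eq_add_of_le (not_lt.1 hi)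
      have hd' := (x.departs_iff t j).1 hd.2
      have hms : m < x.sent (t + 1) j := by omega
      have hA : x.DepartsAs a j t m := ⟨hd.1, hd'.1, hm, hms⟩
      have hF : x.Forwards t j r ↔ x.dest j m = r := by
        rw [forwards_iff, messages, hm, List.getElem?_append_right (by omega)]
        simp [hd'.1, hms]
      rw [Finset.sum_eq_single m, ind_of_true hA, ind_of_true hd,
        ind_congr (and_iff_right hd.1), ind_congr hF]
      · rw [show ind (x.dest j m = r) - c * 1 - 1 * (ind (x.dest j m = r) - c) = 0 by ring, abs_zero]
        exact ind_nonneg _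
      · intro m' _ hne
        rw [ind_of_false fun h => hne (h.eq hA), zero_mul]
      -- Summing over `m < t + 1` is enough: at most `t + 1` messages have been sent by then.
      · intro h
        exact absurd (Finset.mem_range.2 (hms.trans_le (x.sent_le _ _))) h
  · have hF : ¬ (x.sender t = a ∧ x.Forwards t j r) := fun h =>
      hd ⟨h.1, (x.departs_iff_exists_forwards t j).2 ⟨r, h.2⟩⟩
    rw [ind_of_false hd, ind_of_false hF, Finset.sum_eq_zero]
    · simpa using ind_nonneg _
    · intro m _
      rw [ind_of_false fun h => hd ⟨h.1, h.departs⟩, zero_mul]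

/-- Each counted departure uses up one of the initial messages. The induction needs the bound by the
number of departures too, hence the minimum. -/
theorem sum_ind_departs_initial_le (x : MixInput n R) (j : Fin n) (T : ℕ) :
    ∑ t ∈ Finset.range T, ind (x.Departs t j ∧ x.departed t j < (x.init j).length)
      ≤ (x.init j).length := by
  have h : ∑ t ∈ Finset.range T, ind (x.Departs t j ∧ x.departed t j < (x.init j).length)
      ≤ min (x.departed T j : ℝ) (x.init j).length := by
    induction T with
    | zero => simp
    | succ T ih =>
      rw [Finset.sum_range_succ]
      by_cases hd : x.Departs T j
      · rw [departed_succ_of_departs hd]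
        by_cases hi : x.departed T j < (x.init j).length
        · have hi' : (x.departed T j : ℝ) + 1 ≤ (x.init j).length := by exact_mod_cast hi
          rw [ind_of_true ⟨hd, hi⟩]
          push_cast
          rw [min_eq_left hi']
          have := ih.trans (min_le_left _ _)
          linarith
        · rw [ind_of_false fun h => hi h.2, add_zero]
          refine ih.trans (min_le_min_right _ ?_)
          push_cast
          linarith
      · rw [departed_succ_of_not_departs hd, ind_of_false fun h => hd h.1, add_zero]
        exact ih
  exact h.trans (min_le_right _ _)

end MixInput

/-! ### Long-run averages of departures. -/

/-- The averages of the sequence `f` converge to `c`. -/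
def HasAverage (f : ℕ → ℝ) (c : ℝ) : Prop :=
  Tendsto (fun T : ℕ => (∑ t ∈ Finset.range T, f t) / (T : ℝ)) atTop (𝓝 c)

namespace HasAverage

variable {f g : ℕ → ℝ} {c d : ℝ}

theorem add (hf : HasAverage f c) (hg : HasAverage g d) :
    HasAverage (fun t => f t + g t) (c + d) := by
  refine (Tendsto.add hf hg).congr fun T => ?_
  rw [Finset.sum_add_distrib, add_div]

theorem const_mul (hf : HasAverage f c) (b : ℝ) : HasAverage (fun t => b * f t) (b * c) := by
  refine (Tendsto.const_mul b hf).congr fun T => ?_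
  rw [← Finset.mul_sum, mul_div_assoc]

theorem sub (hf : HasAverage f c) (hg : HasAverage g d) :
    HasAverage (fun t => f t - g t) (c - d) := by
  refine (Tendsto.sub hf hg).congr fun T => ?_
  rw [Finset.sum_sub_distrib, sub_div]

theorem const (c : ℝ) : HasAverage (fun _ => c) c := by
  refine tendsto_const_nhds.congr' ?_
  filter_upwards [eventually_ge_atTop 1] with T hT
  have : (T : ℝ) ≠ 0 := by exact_mod_cast (by omega : T ≠ 0)
  rw [Finset.sum_const, Finset.card_range, nsmul_eq_mul, mul_div_cancel_left₀ _ this]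

theorem of_abs_sub_le {e : ℕ → ℝ} {K : ℝ} (hf : HasAverage f c) (h : ∀ t, |g t - f t| ≤ e t)
    (he : ∀ T, ∑ t ∈ Finset.range T, e t ≤ K) : HasAverage g c := by
  have h0 : HasAverage (fun t => g t - f t) 0 := by
    refine squeeze_zero_norm (a := fun T : ℕ => K * ((T : ℝ))⁻¹) (fun T => ?_) ?_
    · rw [Real.norm_eq_abs, abs_div, Nat.abs_cast, div_eq_mul_inv]
      refine mul_le_mul_of_nonneg_right ?_ (by positivity)
      exact (Finset.abs_sum_le_sum_abs _ _).trans ((Finset.sum_le_sum fun t _ => h t).trans (he T))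
    · simpa using (tendsto_inv_atTop_zero.comp
        (tendsto_natCast_atTop_atTop (R := ℝ))).const_mul K
  simpa using h0.add hf

end HasAverage

theorem tendsto_const_div_natCast (b : ℝ) : Tendsto (fun T : ℕ => b / (T : ℝ)) atTop (𝓝 0) :=
  tendsto_const_nhds.div_atTop tendsto_natCast_atTop_atTop

/-- The probability of a departure from queue `j` upon an arrival from `a`. -/
noncomputable def departureRate (n : ℕ) (p : ℝ) (a j : Fin n) : ℝ :=
  if j = a then p else (1 - p) / ((n : ℝ) - 1)

namespace SamplingMix

open MixInput

variable {n k : ℕ} {p : ℝ} {R Ω : Type*} [MeasurableSpace Ω] {μ : Measure Ω} [NeZero n]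
  [IsProbabilityMeasure μ] [Countable R] (X : SamplingMix n k p R μ)

include X in
theorem stepLaw_ne_top (F : Set (Fin n × Finset (Fin n))) : stepLaw n k p F ≠ ⊤ := by
  rw [← X.measure_step 0 F]
  exact measure_ne_top _ _

theorem ae_hasAverage_step (F : Set (Fin n × Finset (Fin n))) :
    ∀ᵐ ω ∂μ, HasAverage (fun t => ind ((X.input ω).step t ∈ F)) (stepLaw n k p F).toReal := by
  filter_upwards [X.ae_tendsto_average_step (N := fun _ _ => True)
    (fun _ _ _ _ h => h) F] with ω hω
  have h : HasAverage (fun t => ind True *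
    (ind ((X.input ω).step t ∈ F) - (stepLaw n k p F).toReal)) 0 := hω
  simpa [ind] using h.add (HasAverage.const (stepLaw n k p F).toReal)

variable (hk : 2 ≤ k) (hkn : k ≤ n) (hp0 : 0 ≤ p) (hp1 : p ≤ 1) (hkp : k = n → p = 1)

include hk hkn hp0 hp1 hkp

theorem ae_hasAverage_sender (a : Fin n) :
    ∀ᵐ ω ∂μ, HasAverage (fun t => ind ((X.input ω).sender t = a)) (n : ℝ)⁻¹ := by
  filter_upwards [X.ae_hasAverage_step {z | z.1 = a}] with ω hω
  rwa [toReal_stepLaw_sender_eq hp0 hp1 hk hkn hkp] at hω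

/-- Queue `j` gains a message at rate `1/n` and is released at rate `k/n`, so the drift of the
reflected walk is negative as `k ≥ 2`. -/
theorem ae_tendsto_length_buffer_div (j : Fin n) :
    ∀ᵐ ω ∂μ, Tendsto (fun T : ℕ => (((X.input ω).buffer T j).length : ℝ) / (T : ℝ)) atTop
      (𝓝 0) := by
  filter_upwards [X.ae_hasAverage_sender hk hkn hp0 hp1 hkp j,
    X.ae_hasAverage_step {z | j ∈ z.2}] with ω h1 h2
  rw [toReal_stepLaw_released hp0 hp1 hk hkn hkp] at h2
  have h3 := h1.sub h2
  rw [show (n : ℝ)⁻¹ - (n : ℝ)⁻¹ * k = -((n : ℝ)⁻¹ * (k - 1)) by ring] at h3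
  refine tendsto_reflected_walk_div ?_ (Nat.cast_nonneg _)
    (fun t => (X.input ω).length_buffer_succ t j) h3
  have : (2 : ℝ) ≤ k := by exact_mod_cast hk
  exact mul_nonneg (by positivity) (by linarith)

/-- Conservation: departures equal initial contents plus messages sent minus the current length, and
the first and the last are sublinear. -/
theorem ae_hasAverage_departs (j : Fin n) :
    ∀ᵐ ω ∂μ, HasAverage (fun t => ind ((X.input ω).Departs t j)) (n : ℝ)⁻¹ := by
  filter_upwards [X.ae_hasAverage_sender hk hkn hp0 hp1 hkp j,
    X.ae_tendsto_length_buffer_div hk hkn hp0 hp1 hkp j] with ω h1 h2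
  have h3 := (Tendsto.add h1 (tendsto_const_div_natCast ((X.input ω).init j).length)).sub h2
  rw [add_zero, sub_zero] at h3
  refine h3.congr fun T => ?_
  rw [← cast_departed, ← cast_sent, ← add_div, ← sub_div]
  congr 1
  have := (X.input ω).length_buffer_add_departed T j
  have : (((X.input ω).buffer T j).length : ℝ) + (X.input ω).departed T j
    = ((X.input ω).init j).length + (X.input ω).sent T j := by exact_mod_cast this
  linarith

include X in
theorem toReal_stepLaw_ne_sender (j : Fin n) :
    (stepLaw n k p {z | z.1 ≠ j ∧ j ∈ z.2}).toReal = (n : ℝ)⁻¹ * (k - p) := by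
  have h : stepLaw n k p {z | j ∈ z.2}
      = stepLaw n k p {z | z.1 = j ∧ j ∈ z.2} + stepLaw n k p {z | z.1 ≠ j ∧ j ∈ z.2} := by
    simp only [stepLaw, ← Finset.sum_add_distrib]
    refine Finset.sum_congr rfl fun z _ => ?_
    classical
    simp only [Set.indicator_apply, Set.mem_ofPred_eq]
    by_cases h1 : z.1 = j <;> simp [h1]
  have h' := congrArg ENNReal.toReal h
  rw [ENNReal.toReal_add (X.stepLaw_ne_top _) (X.stepLaw_ne_top _),
    toReal_stepLaw_released hp0 hp1 hk hkn hkp, toReal_stepLaw_sender_self hp0 hp1 hk hkn] at h'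
  linarith

/-- Balance of rates: of the departure rate `1/n`, arrivals from `j` provide `p/n`. The rest is the
fraction of non-empty times multiplied by `(k - p)/n`, since emptiness before an arrival is
independent of its step. Solving for the fraction gives the claim. -/
theorem ae_hasAverage_buffer_ne_nil (j : Fin n) :
    ∀ᵐ ω ∂μ, HasAverage (fun t => ind ((X.input ω).buffer t j ≠ [])) ((1 - p) / (k - p)) := by
  have hn : (n : ℝ) ≠ 0 := by exact_mod_cast NeZero.ne n
  have hkp' : (k : ℝ) - p ≠ 0 := by
    have : (2 : ℝ) ≤ k := by exact_mod_cast hk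
    linarith
  filter_upwards [X.ae_hasAverage_departs hk hkn hp0 hp1 hkp j,
    X.ae_hasAverage_step {z | z.1 = j ∧ j ∈ z.2},
    X.ae_tendsto_average_step (N := fun t x => x.buffer t j ≠ [])
      (fun t => buffer_ne_nil_of_hist_eq) {z | z.1 ≠ j ∧ j ∈ z.2}] with ω h1 h2 h3
  rw [toReal_stepLaw_sender_self hp0 hp1 hk hkn] at h2
  rw [X.toReal_stepLaw_ne_sender hk hkn hp0 hp1 hkp] at h3
  have h4 := ((h1.sub h2).sub (g := fun t => ind ((X.input ω).buffer t j ≠ []) *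
    (ind ((X.input ω).step t ∈ {z : Fin n × Finset (Fin n) | z.1 ≠ j ∧ j ∈ z.2})
      - (n : ℝ)⁻¹ * (k - p))) h3).const_mul ((n : ℝ) / (k - p))
  have h5 : (n : ℝ) / (k - p) * ((n : ℝ)⁻¹ - (n : ℝ)⁻¹ * p - 0) = (1 - p) / (k - p) := by
    field_simp
    ring
  rw [h5] at h4
  convert! h4 using 2 with t
  have h6 : ind ((X.input ω).Departs t j)
      = ind ((X.input ω).step t ∈ {z : Fin n × Finset (Fin n) | z.1 = j ∧ j ∈ z.2})
        + ind ((X.input ω).buffer t j ≠ []) *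
          ind ((X.input ω).step t ∈ {z : Fin n × Finset (Fin n) | z.1 ≠ j ∧ j ∈ z.2}) := by
    by_cases hs : (X.input ω).sender t = j
    · rw [ind_congr (departs_iff_of_sender_eq hs)]
      simp [ind, step, hs]
    · rw [ind_congr (departs_iff_of_sender_ne hs), ind_and]
      simp [ind, step, hs]
  simp only [Set.mem_ofPred_eq] at h6 ⊢
  rw [h6]
  field_simp
  ring

/-- For `j ≠ a` the factor `k - p` of the release probability cancels against the denominator of the
non-empty fraction, so the rate does not depend on `k`. -/
theorem ae_hasAverage_sender_departs (a j : Fin n) :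
    ∀ᵐ ω ∂μ, HasAverage (fun t => ind ((X.input ω).sender t = a ∧ (X.input ω).Departs t j))
      ((n : ℝ)⁻¹ * departureRate n p a j) := by
  by_cases hj : j = a
  · subst hj
    filter_upwards [X.ae_hasAverage_step {z | z.1 = j ∧ j ∈ z.2}] with ω h
    rw [toReal_stepLaw_sender_self hp0 hp1 hk hkn] at h
    rw [departureRate, if_pos rfl]
    convert! h using 2 with t
    exact ind_congr (and_congr_right fun h => departs_iff_of_sender_eq h)
  · have hkp' : (k : ℝ) - p ≠ 0 := by
      have : (2 : ℝ) ≤ k := by exact_mod_cast hk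
      linarith
    filter_upwards [X.ae_hasAverage_buffer_ne_nil hk hkn hp0 hp1 hkp j,
      X.ae_tendsto_average_step (N := fun t x => x.buffer t j ≠ [])
        (fun t => buffer_ne_nil_of_hist_eq) {z | z.1 = a ∧ j ∈ z.2}] with ω h1 h2
    rw [toReal_stepLaw_sender_other hp0 hp1 hk hkn hkp hj] at h2
    have h3 := (h1.const_mul ((n : ℝ)⁻¹ * ((k - p) / ((n : ℝ) - 1)))).add
      (g := fun t => ind ((X.input ω).buffer t j ≠ []) *
        (ind ((X.input ω).step t ∈ {z : Fin n × Finset (Fin n) | z.1 = a ∧ j ∈ z.2})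
          - (n : ℝ)⁻¹ * ((k - p) / ((n : ℝ) - 1)))) h2
    have h5 : (n : ℝ)⁻¹ * ((k - p) / ((n : ℝ) - 1)) * ((1 - p) / (k - p)) + 0
        = (n : ℝ)⁻¹ * departureRate n p a j := by
      rw [departureRate, if_neg hj, add_zero, mul_assoc]
      congr 1
      field_simp
    rw [h5] at h3
    convert! h3 using 2 with t
    have h6 : ind ((X.input ω).sender t = a ∧ (X.input ω).Departs t j)
        = ind ((X.input ω).buffer t j ≠ []) *
          ind ((X.input ω).step t ∈ {z : Fin n × Finset (Fin n) | z.1 = a ∧ j ∈ z.2}) := by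
      rw [← ind_and]
      refine ind_congr ⟨fun h => ?_, fun h => ?_⟩
      · have := (departs_iff_of_sender_ne (j := j) (by rw [h.1]; exact Ne.symm hj)).1 h.2
        exact ⟨this.1, h.1, this.2⟩
      · have hs : (X.input ω).sender t = a := h.2.1
        exact ⟨hs, (departs_iff_of_sender_ne (by rw [hs]; exact Ne.symm hj)).2 ⟨h.1, h.2.2⟩⟩
    rw [h6]
    ring

omit [NeZero n] [IsProbabilityMeasure μ] [Countable R] hk hkn hp0 hp1 hkp

theorem measurableSet_dest (j : Fin n) (m : ℕ) (r : R) :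
    MeasurableSet[(MixSource.dest j m).sigma X.input] {ω | (X.input ω).dest j m = r} :=
  ⟨{r}, trivial, rfl⟩

/-- The address of a message is independent of everything but the addresses, together with the
address of another message. -/
theorem indep_dest (j : Fin n) {m m' : ℕ} (hm : m ≠ m') :
    Indep (X.undirected ⊔ (MixSource.dest j m).sigma X.input)
      ((MixSource.dest j m').sigma X.input) μ := by
  have hdisj : Disjoint ({v : MixSource n | ∀ i l, v ≠ .dest i l} ∪ {.dest j m}) {.dest j m'} := by
    rw [Set.disjoint_singleton_right]
    rintro (h | h)
    · exact h j m' rfl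
    · simp only [Set.mem_singleton_iff, MixSource.dest.injEq, true_and] at h
      exact hm h.symm
  have h := indep_iSup_of_disjoint X.sigma_le X.indep hdisj
  rwa [iSup_union, iSup_singleton, iSup_singleton] at h

variable [NeZero n] [IsProbabilityMeasure μ] [Countable R]

/-- The sum over `m` is the centred address of the message departing at time `t`, if that message
was sent after the start. These variables are orthogonal because departure times do not depend on
addresses and distinct messages have independent addresses. -/
theorem ae_hasAverage_departsAs (a j : Fin n) (r : R) :
    ∀ᵐ ω ∂μ, HasAverage (fun t => ∑ m ∈ Finset.range (t + 1),
      ind ((X.input ω).DepartsAs a j t m) *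
        (ind ((X.input ω).dest j m = r) - (X.choice j r).toReal)) 0 := by
  set c := (X.choice j r).toReal with hc
  have hc0 : 0 ≤ c := ENNReal.toReal_nonneg
  have hc1 : c ≤ 1 := by
    rw [hc, ← X.law_dest j 0 r]
    exact measureReal_le_one
  have hmA : ∀ t m, Measurable[X.undirected] fun ω => ind ((X.input ω).DepartsAs a j t m) :=
    fun t m => @measurable_ind _ X.undirected _ (X.measurableSet_of_hist (t + 1)
      (N := fun x => x.DepartsAs a j t m) departsAs_of_hist_eq)
  have hmD : ∀ m, Measurable[(MixSource.dest j m).sigma X.input]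
      fun ω => ind ((X.input ω).dest j m = r) - c := fun m =>
    (@measurable_ind _ ((MixSource.dest j m).sigma X.input) _
      (X.measurableSet_dest j m r)).sub_const c
  have hmA' : ∀ t m, Measurable fun ω => ind ((X.input ω).DepartsAs a j t m) := fun t m =>
    (hmA t m).mono X.undirected_le le_rfl
  have hmD' : ∀ m, Measurable fun ω => ind ((X.input ω).dest j m = r) - c := fun m =>
    (hmD m).mono (X.sigma_le _) le_rfl
  have hDb : ∀ m ω, |ind ((X.input ω).dest j m = r) - c| ≤ 1 := fun m ω => by
    rw [abs_le]
    constructor <;> linarith [ind_nonneg ((X.input ω).dest j m = r),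
      ind_le_one ((X.input ω).dest j m = r)]
  have hterm : ∀ t m ω, |ind ((X.input ω).DepartsAs a j t m) *
      (ind ((X.input ω).dest j m = r) - c)| ≤ 1 := fun t m ω => by
    rw [abs_mul, abs_of_nonneg (ind_nonneg _)]
    exact mul_le_one₀ (ind_le_one _) (abs_nonneg _) (hDb m ω)
  refine ae_tendsto_average_of_orthogonal (C := 1)
    (fun t => Finset.measurable_sum _ fun m _ => (hmA' t m).mul (hmD' m)) (fun t ω => ?_)
    fun s t hst => ?_
  -- At most one summand is non-zero, as the number of earlier departures determines `m`.
  · beta_reduce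
    by_cases h : ∃ m, (X.input ω).DepartsAs a j t m
    · obtain ⟨m, hm⟩ := h
      by_cases hmr : m ∈ Finset.range (t + 1)
      · rw [Finset.sum_eq_single m]
        · exact hterm t m ω
        · intro m' _ hne
          rw [ind_of_false fun h => hne (h.eq hm), zero_mul]
        · exact fun h => absurd hmr h
      · rw [Finset.sum_eq_zero]
        · simp
        · intro m' hm'
          have : ¬ (X.input ω).DepartsAs a j t m' := fun h => hmr (h.eq hm ▸ hm')
          rw [ind_of_false this, zero_mul]
    · rw [Finset.sum_eq_zero]
      · simp
      · intro m _
        rw [ind_of_false fun hm => h ⟨m, hm⟩, zero_mul]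
  · simp_rw [Finset.sum_mul_sum]
    have hint : ∀ m m', Integrable (fun ω => ind ((X.input ω).DepartsAs a j s m) *
        (ind ((X.input ω).dest j m = r) - c) * (ind ((X.input ω).DepartsAs a j t m') *
        (ind ((X.input ω).dest j m' = r) - c))) μ := fun m m' =>
      Integrable.of_bound (((hmA' s m).mul (hmD' m)).mul
        ((hmA' t m').mul (hmD' m'))).aestronglyMeasurable 1 (ae_of_all _ fun ω => by
          rw [Real.norm_eq_abs, abs_mul]
          exact mul_le_one₀ (hterm s m ω) (abs_nonneg _) (hterm t m' ω))
    rw [integral_finsetSum _ fun m _ => integrable_finsetSum _ fun m' _ => hint m m']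
    refine Finset.sum_eq_zero fun m _ => ?_
    rw [integral_finsetSum _ fun m' _ => hint m m']
    refine Finset.sum_eq_zero fun m' _ => ?_
    -- The same message cannot depart at both times; for different messages the address of `m'` is
    -- independent of all other factors.
    by_cases hm : m = m'
    · subst hm
      have : ∀ ω, ind ((X.input ω).DepartsAs a j s m) *
          (ind ((X.input ω).dest j m = r) - c) * (ind ((X.input ω).DepartsAs a j t m) *
          (ind ((X.input ω).dest j m = r) - c)) = 0 := fun ω => by
        by_cases h : (X.input ω).DepartsAs a j s m
        · rw [ind_of_false (h.not_of_lt hst)]; ring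
        · rw [ind_of_false h]; ring
      simp_rw [this]
      exact integral_zero _ _
    · have h0 : ∫ ω, (ind ((X.input ω).dest j m' = r) - c) ∂μ = 0 := by
        have hms : MeasurableSet {ω | (X.input ω).dest j m' = r} :=
          X.sigma_le _ _ (X.measurableSet_dest j m' r)
        rw [integral_sub _ (integrable_const _), integral_ind hms]
        · simp [Measure.real, X.law_dest, hc]
        · exact Integrable.of_bound (measurable_ind hms).aestronglyMeasurable 1
            (ae_of_all _ fun ω => by
              rw [Real.norm_eq_abs, abs_of_nonneg (ind_nonneg _)]; exact ind_le_one _)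
      have hg : Measurable[X.undirected ⊔ (MixSource.dest j m).sigma X.input] fun ω =>
          ind ((X.input ω).DepartsAs a j s m) * (ind ((X.input ω).dest j m = r) - c) *
            ind ((X.input ω).DepartsAs a j t m') :=
        (((hmA s m).mono le_sup_left le_rfl).mul ((hmD m).mono le_sup_right le_rfl)).mul
          ((hmA t m').mono le_sup_left le_rfl)
      have := integral_mul_eq_zero_of_indep (sup_le X.undirected_le (X.sigma_le _))
        (X.sigma_le _) (X.indep_dest j hm) hg (hmD m') h0
      simpa only [mul_assoc] using this

include hk hkn hp0 hp1 hkp in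
theorem ae_hasAverage_forwards (a j : Fin n) (r : R) :
    ∀ᵐ ω ∂μ, HasAverage (fun t => ind ((X.input ω).sender t = a ∧ (X.input ω).Forwards t j r))
      ((n : ℝ)⁻¹ * ((X.choice j r).toReal * departureRate n p a j)) := by
  have hc0 : 0 ≤ (X.choice j r).toReal := ENNReal.toReal_nonneg
  have hc1 : (X.choice j r).toReal ≤ 1 := by
    rw [← X.law_dest j 0 r]
    exact measureReal_le_one
  filter_upwards [X.ae_hasAverage_sender_departs hk hkn hp0 hp1 hkp a j,
    X.ae_hasAverage_departsAs a j r] with ω h1 h2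
  have h3 := (h1.const_mul (X.choice j r).toReal).add h2
  rw [add_zero, mul_left_comm] at h3
  refine h3.of_abs_sub_le (fun t => ?_) ((X.input ω).sum_ind_departs_initial_le j)
  have := (X.input ω).abs_ind_forwards_sub_le a j r t hc0 hc1
  rwa [sub_sub] at this

end SamplingMix

/-! ### From forwarded messages to the record of the adversary. -/

namespace MixInput

variable {n : ℕ} [NeZero n] {R : Type*}

theorem arrivals_record [Fintype R] (x : MixInput n R) (T : ℕ) (a : Fin n) :
    (arrivals (x.record T) a : ℝ) = ∑ t ∈ Finset.range T, ind (x.sender t = a) := by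
  induction T with
  | zero => simp [arrivals, record]
  | succ T ih =>
    rw [Finset.sum_range_succ, ← ih]
    simp only [arrivals, record, Multiset.range_succ, Multiset.map_cons, Multiset.countP_cons]
    push_cast
    congr 1
    have hiff : (x.round T).1 = a ↔ x.sender T = a := Iff.rfl
    by_cases h : x.sender T = a
    · rw [ind_of_true h, if_pos (hiff.2 h)]
    · rw [ind_of_false h, if_neg (mt hiff.1 h)]

theorem departures_record [Fintype R] (x : MixInput n R) (T : ℕ) (a : Fin n) (r : R) :
    (departures (x.record T) a r : ℝ)
      = ∑ t ∈ Finset.range T, ind (x.sender t = a ∧ ∃ j, x.Forwards t j r) := by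
  induction T with
  | zero => simp [departures, record]
  | succ T ih =>
    rw [Finset.sum_range_succ, ← ih]
    simp only [departures, record, Multiset.range_succ, Multiset.map_cons, Multiset.countP_cons]
    push_cast
    congr 1
    have hiff : (x.round T).1 = a ∧ r ∈ (x.round T).2
        ↔ x.sender T = a ∧ ∃ j, x.Forwards T j r := by
      simp only [round, Finset.mem_filter, Finset.mem_univ, true_and]
    by_cases h : x.sender T = a ∧ ∃ j, x.Forwards T j r
    · rw [ind_of_true h, if_pos (hiff.2 h)]
    · rw [ind_of_false h, if_neg (mt hiff.1 h)]

theorem Forwards.mem {x : MixInput n R} {t : ℕ} {j : Fin n} {r : R} {S : Set R}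
    (h : x.Forwards t j r) (hi : ∀ r ∈ x.init j, r ∈ S) (hd : ∀ m, x.dest j m ∈ S) : r ∈ S := by
  have := List.mem_of_getElem? ((x.forwards_iff t j r).1 h).2
  rw [messages, List.mem_append, List.mem_map] at this
  rcases this with h | ⟨m, -, rfl⟩
  · exact hi r h
  · exact hd m

end MixInput

namespace SamplingMix

open MixInput

variable {n k : ℕ} {p : ℝ} {R Ω : Type*} [MeasurableSpace Ω] {μ : Measure Ω}

theorem toReal_choice_pos (X : SamplingMix n k p R μ) {j : Fin n} {r : R} (hr : r ∈ X.recv j) :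
    0 < (X.choice j r).toReal := by
  have h : r ∈ (X.choice j).support := by
    rw [X.support_choice]
    exact hr
  exact ENNReal.toReal_pos ((PMF.mem_support_iff _ _).1 h) (PMF.apply_ne_top _ _)

theorem ae_dest_mem [Countable R] (X : SamplingMix n k p R μ) :
    ∀ᵐ ω ∂μ, ∀ j m, (X.input ω).dest j m ∈ X.recv j := by
  refine ae_all_iff.2 fun j => ae_all_iff.2 fun m => ?_
  have h : ∀ᵐ ω ∂μ, ∀ r, r ∉ X.recv j → (X.input ω).dest j m ≠ r := by
    refine ae_all_iff.2 fun r => ?_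
    by_cases hr : r ∈ X.recv j
    · exact ae_of_all _ fun ω h => absurd hr h
    · have : X.choice j r = 0 := by
        rw [PMF.apply_eq_zero_iff, X.support_choice]
        exact hr
      rw [ae_iff]
      simpa [hr, X.law_dest] using this
  filter_upwards [h] with ω hω
  by_contra hr
  exact hω _ hr rfl

/-- Receiver sets are disjoint, so a recipient betrays the queue from which its message came,
although the adversary does not see queues. -/
theorem exists_forwards_iff (X : SamplingMix n k p R μ) [NeZero n] {ω : Ω}
    (hω : ∀ j m, (X.input ω).dest j m ∈ X.recv j) {j : Fin n} {r : R} (hr : r ∈ X.recv j) (t : ℕ) :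
    (∃ j', (X.input ω).Forwards t j' r) ↔ (X.input ω).Forwards t j r := by
  refine ⟨fun ⟨j', h⟩ => ?_, fun h => ⟨j, h⟩⟩
  by_cases hj : j = j'
  · rwa [hj]
  · exact absurd (h.mem (S := X.recv j') (X.init_mem ω j') (hω j'))
      (Finset.disjoint_left.1 (X.recv_disjoint j j' hj) hr)

theorem departures_eq_zero (X : SamplingMix n k p R μ) [NeZero n] [Fintype R] {ω : Ω}
    (hω : ∀ j m, (X.input ω).dest j m ∈ X.recv j) {r : R} (hr : ∀ j, r ∉ X.recv j) (T : ℕ)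
    (a : Fin n) : departures ((X.input ω).record T) a r = 0 := by
  have h : (departures ((X.input ω).record T) a r : ℝ) = 0 := by
    rw [departures_record]
    refine Finset.sum_eq_zero fun t _ => ind_of_false ?_
    rintro ⟨-, j, h⟩
    exact hr j (h.mem (S := X.recv j) (X.init_mem ω j) (hω j))
  exact_mod_cast h

variable [NeZero n] [IsProbabilityMeasure μ] (X : SamplingMix n k p R μ)
variable (hk : 2 ≤ k) (hkn : k ≤ n) (hp0 : 0 ≤ p) (hp1 : p ≤ 1) (hkp : k = n → p = 1)

include hk hkn hp0 hp1 hkp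

theorem ae_tendsto_arrivals [Fintype R] :
    ∀ᵐ ω ∂μ, ∀ a, Tendsto (fun T : ℕ => (arrivals ((X.input ω).record T) a : ℝ) / (T : ℝ)) atTop
      (𝓝 (n : ℝ)⁻¹) := by
  refine ae_all_iff.2 fun a => ?_
  filter_upwards [X.ae_hasAverage_sender hk hkn hp0 hp1 hkp a] with ω h
  refine Tendsto.congr (fun T => ?_) h
  rw [arrivals_record]

/-- The departure frequencies per arrival of a sender. -/
theorem ae_tendsto_departures_div_arrivals [Fintype R] :
    ∀ᵐ ω ∂μ, ∀ a j, ∀ r ∈ X.recv j,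
      Tendsto (fun T => (departures ((X.input ω).record T) a r : ℝ) /
        (arrivals ((X.input ω).record T) a : ℝ)) atTop
          (𝓝 ((X.choice j r).toReal * departureRate n p a j)) := by
  have hn : (n : ℝ)⁻¹ ≠ 0 := inv_ne_zero (by exact_mod_cast NeZero.ne n)
  have h : ∀ᵐ ω ∂μ, ∀ a j r, HasAverage
      (fun t => ind ((X.input ω).sender t = a ∧ (X.input ω).Forwards t j r))
      ((n : ℝ)⁻¹ * ((X.choice j r).toReal * departureRate n p a j)) :=
    ae_all_iff.2 fun a => ae_all_iff.2 fun j => ae_all_iff.2 fun r =>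
      X.ae_hasAverage_forwards hk hkn hp0 hp1 hkp a j r
  filter_upwards [h, X.ae_tendsto_arrivals hk hkn hp0 hp1 hkp, X.ae_dest_mem] with ω h1 h2 h3
  intro a j r hr
  have h4 := Tendsto.div (h1 a j r) (h2 a) hn
  rw [mul_div_cancel_left₀ _ hn] at h4
  refine h4.congr' ?_
  filter_upwards [eventually_ge_atTop 1] with T hT
  have hT0 : (T : ℝ) ≠ 0 := by exact_mod_cast (by omega : T ≠ 0)
  simp only [Pi.div_apply]
  rw [div_div_div_cancel_right₀ hT0, departures_record]
  congr 1
  exact Finset.sum_congr rfl fun t _ => ind_congr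
    (and_congr_right fun _ => (X.exists_forwards_iff h3 hr t).symm)

/-! ### Steady state. -/

omit [NeZero n] [IsProbabilityMeasure μ] hk hkn hp0 hp1 hkp

/-- Only an inequality, since countable subadditivity requires no measurability of the events about
`buffer t`; the events about `init` are measurable and disjoint. -/
theorem measure_buffer_le [NeZero n] [Countable R] (hX : X.InSteadyState) (t : ℕ)
    (S : Set (Fin n → List R)) :
    μ {ω | (X.input ω).buffer t ∈ S} ≤ μ {ω | (X.input ω).init ∈ S} := by
  have h : ∀ f : Ω → Fin n → List R, {ω | f ω ∈ S} = ⋃ b ∈ S, {ω | f ω = b} := fun f => by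
    ext ω; simp
  rw [h, h]
  refine (measure_biUnion_le _ S.to_countable _).trans (le_of_eq ?_)
  rw [measure_biUnion S.to_countable]
  · exact tsum_congr fun b => hX t b
  · exact fun b _ b' _ hne => Set.disjoint_left.2 fun ω h1 h2 => hne (h1.symm.trans h2)
  · exact fun b _ => X.sigma_le .init _ ⟨{b}, trivial, rfl⟩

theorem measurableSet_buffer_ne_nil [NeZero n] [Countable R] (t : ℕ) (j : Fin n) :
    MeasurableSet {ω | (X.input ω).buffer t j ≠ []} :=
  X.undirected_le _ (X.measurableSet_of_hist t (N := fun x => x.buffer t j ≠ [])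
    buffer_ne_nil_of_hist_eq)

variable [NeZero n] [IsProbabilityMeasure μ]

/-- The inequality for an event and for its complement together force equality. -/
theorem measureReal_buffer_ne_nil_eq [Countable R] (hX : X.InSteadyState) (t : ℕ) (j : Fin n) :
    μ.real {ω | (X.input ω).buffer t j ≠ []} = μ.real {ω | (X.input ω).buffer 0 j ≠ []} := by
  have hle : ∀ S : Set (Fin n → List R), μ.real {ω | (X.input ω).buffer t ∈ S}
      ≤ μ.real {ω | (X.input ω).buffer 0 ∈ S} := fun S =>
    ENNReal.toReal_mono (measure_ne_top _ _) (X.measure_buffer_le hX t S)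
  have h1 := hle {b | b j ≠ []}
  have h2 := hle {b | b j ≠ []}ᶜ
  have hc : ∀ t, μ.real {ω | (X.input ω).buffer t ∈ ({b | b j ≠ []}ᶜ : Set (Fin n → List R))}
      = 1 - μ.real {ω | (X.input ω).buffer t j ≠ []} := fun t =>
    probReal_compl_eq_one_sub (X.measurableSet_buffer_ne_nil t j)
  rw [hc, hc] at h2
  exact le_antisymm h1 (by linarith)

include hk hkn hp0 hp1 hkp

/-- A probability that is constant in time equals the expected average over time, which converges to
the almost sure limit by dominated convergence. -/
theorem measureReal_buffer_ne_nil [Countable R] (hX : X.InSteadyState) (t : ℕ) (j : Fin n) :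
    μ.real {ω | (X.input ω).buffer t j ≠ []} = (1 - p) / (k - p) := by
  rw [X.measureReal_buffer_ne_nil_eq hX]
  have hm : ∀ t, Measurable fun ω => ind ((X.input ω).buffer t j ≠ []) := fun t =>
    measurable_ind (X.measurableSet_buffer_ne_nil t j)
  have hint : ∀ t, Integrable (fun ω => ind ((X.input ω).buffer t j ≠ [])) μ := fun t =>
    Integrable.of_bound (hm t).aestronglyMeasurable 1 (ae_of_all _ fun ω => by
      rw [Real.norm_eq_abs, abs_of_nonneg (ind_nonneg _)]; exact ind_le_one _)
  have h := tendsto_integral_of_dominated_convergence (μ := μ) (fun _ => (1 : ℝ))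
    (F := fun (T : ℕ) ω => (∑ t ∈ Finset.range T, ind ((X.input ω).buffer t j ≠ [])) / (T : ℝ))
    (f := fun _ => (1 - p) / (k - p))
    (fun T => ((Finset.measurable_sum _ fun t _ => hm t).div_const _).aestronglyMeasurable)
    (integrable_const _) (fun T => ae_of_all _ fun ω => ?_)
    (X.ae_hasAverage_buffer_ne_nil hk hkn hp0 hp1 hkp j)
  · simp only [integral_const, probReal_univ, one_smul] at h
    refine tendsto_nhds_unique (tendsto_const_nhds.congr' ?_) h
    filter_upwards [eventually_ge_atTop 1] with T hT
    have hT0 : (T : ℝ) ≠ 0 := by exact_mod_cast (by omega : T ≠ 0)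
    rw [integral_div, integral_finsetSum _ fun t _ => hint t]
    simp_rw [fun t => integral_ind (μ := μ) (X.measurableSet_buffer_ne_nil t j),
      X.measureReal_buffer_ne_nil_eq hX]
    rw [Finset.sum_const, Finset.card_range, nsmul_eq_mul, mul_div_cancel_left₀ _ hT0]
  · rw [Real.norm_eq_abs, abs_div, Nat.abs_cast,
      abs_of_nonneg (Finset.sum_nonneg fun t _ => ind_nonneg _)]
    refine div_le_one_of_le₀ ?_ (Nat.cast_nonneg _)
    simpa using Finset.sum_le_card_nsmul (Finset.range T)
      (fun t => ind ((X.input ω).buffer t j ≠ [])) 1 fun t _ => ind_le_one _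

/-- In steady state, the conditional probability of a departure from queue `j` given that the
arriving message is from sender `a`. -/
theorem cond_exists_forwards [Countable R] (hX : X.InSteadyState) (t : ℕ) (a j : Fin n) :
    (cond μ {ω | (X.input ω).sender t = a}).real {ω | ∃ r, (X.input ω).Forwards t j r}
      = departureRate n p a j := by
  have hn : (n : ℝ) ≠ 0 := by exact_mod_cast NeZero.ne n
  have hms : MeasurableSet {ω | (X.input ω).sender t = a} :=
    X.undirected_le _ (X.measurableSet_step t {z | z.1 = a})
  have hs : μ.real {ω | (X.input ω).sender t = a} = (n : ℝ)⁻¹ := by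
    rw [← toReal_stepLaw_sender_eq hp0 hp1 hk hkn hkp a, ← X.measure_step t]
    rfl
  rw [Measure.real, cond_apply hms, ENNReal.toReal_mul, ENNReal.toReal_inv, ← Measure.real, hs,
    inv_inv, ← Measure.real]
  by_cases hj : j = a
  · subst hj
    have h : {ω | (X.input ω).sender t = j} ∩ {ω | ∃ r, (X.input ω).Forwards t j r}
        = {ω | (X.input ω).step t ∈ {z : Fin n × Finset (Fin n) | z.1 = j ∧ j ∈ z.2}} := by
      ext ω
      simp only [Set.mem_inter_iff, Set.mem_ofPred_eq, ← departs_iff_exists_forwards]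
      exact and_congr_right fun h => departs_iff_of_sender_eq h
    rw [h, Measure.real, X.measure_step, toReal_stepLaw_sender_self hp0 hp1 hk hkn, departureRate,
      if_pos rfl, mul_inv_cancel_left₀ hn]
  · have h : {ω | (X.input ω).sender t = a} ∩ {ω | ∃ r, (X.input ω).Forwards t j r}
        = {ω | (X.input ω).buffer t j ≠ [] ∧
          (X.input ω).step t ∈ {z : Fin n × Finset (Fin n) | z.1 = a ∧ j ∈ z.2}} := by
      ext ω
      simp only [Set.mem_inter_iff, Set.mem_ofPred_eq, ← departs_iff_exists_forwards]
      constructor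
      · rintro ⟨h1, h2⟩
        have := (departs_iff_of_sender_ne (by rw [h1]; exact Ne.symm hj)).1 h2
        exact ⟨this.1, h1, this.2⟩
      · rintro ⟨h1, h2, h3⟩
        have hs : (X.input ω).sender t = a := h2
        exact ⟨hs, (departs_iff_of_sender_ne (by rw [hs]; exact Ne.symm hj)).2 ⟨h1, h3⟩⟩
    have hkp' : (k : ℝ) - p ≠ 0 := by
      have : (2 : ℝ) ≤ k := by exact_mod_cast hk
      linarith
    have hb := X.measureReal_buffer_ne_nil hk hkn hp0 hp1 hkp hX t j
    rw [Measure.real] at hb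
    rw [h, Measure.real, X.measure_inter_step t (N := fun x => x.buffer t j ≠ [])
      buffer_ne_nil_of_hist_eq, ENNReal.toReal_mul, hb,
      toReal_stepLaw_sender_other hp0 hp1 hk hkn hkp hj, departureRate, if_neg hj]
    field_simp

end SamplingMix

/-! ### The attack and its correctness. -/

section Attack

open MixInput

variable {n k : ℕ} {p : ℝ}

theorem exists_ne_of_two_le (hn : 2 ≤ n) (a : Fin n) : ∃ b, b ≠ a := by
  have : Nontrivial (Fin n) := Fin.nontrivial_iff_two_le.2 hn
  exact exists_ne a

theorem lt_div_sub_one_iff (hn : 2 ≤ n) : (1 - p) / ((n : ℝ) - 1) < p ↔ 1 / (n : ℝ) < p := by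
  have h2 : (2 : ℝ) ≤ n := by exact_mod_cast hn
  rw [div_lt_iff₀ (by linarith), div_lt_iff₀ (by linarith)]
  constructor <;> intro h <;> linarith

theorem div_sub_one_lt_iff (hn : 2 ≤ n) : p < (1 - p) / ((n : ℝ) - 1) ↔ p < 1 / (n : ℝ) := by
  have h2 : (2 : ℝ) ≤ n := by exact_mod_cast hn
  rw [lt_div_iff₀ (by linarith), lt_div_iff₀ (by linarith)]
  constructor <;> intro h <;> linarith

variable [NeZero n]

/-- The relative frequency of departures to `r` upon arrivals from `a`. -/
noncomputable def departureFrequency {R : Type*} (M : Multiset (Fin n × Finset R)) (a : Fin n)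
    (r : R) : ℝ :=
  (departures M a r : ℝ) / (arrivals M a : ℝ)

open Classical in
/-- The attack which compares the frequencies of departures to a receiver upon arrivals from the
target and from the other senders. -/
noncomputable def frequencyAttack (n : ℕ) [NeZero n] (p : ℝ) (R : Type*) [Fintype R] :
    StatelessAttack n R := fun a M =>
  Finset.univ.filter fun r => ∀ b, b ≠ a →
    if 1 / (n : ℝ) < p then departureFrequency M b r < departureFrequency M a r
    else departureFrequency M a r < departureFrequency M b r

theorem mem_frequencyAttack_of_lt {R : Type*} [Fintype R] (hp : 1 / (n : ℝ) < p) {a : Fin n}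
    {M : Multiset (Fin n × Finset R)} {r : R} : r ∈ frequencyAttack n p R a M ↔
      ∀ b, b ≠ a → departureFrequency M b r < departureFrequency M a r := by
  simp only [frequencyAttack, Finset.mem_filter, Finset.mem_univ, true_and, if_pos hp]

theorem mem_frequencyAttack_of_not_lt {R : Type*} [Fintype R] (hp : ¬ 1 / (n : ℝ) < p) {a : Fin n}
    {M : Multiset (Fin n × Finset R)} {r : R} : r ∈ frequencyAttack n p R a M ↔
      ∀ b, b ≠ a → departureFrequency M a r < departureFrequency M b r := by
  simp only [frequencyAttack, Finset.mem_filter, Finset.mem_univ, true_and, if_neg hp]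

/-- For `r` in the set of `j`, all limiting frequencies share the positive factor `X.choice j r`, so
their order is that of the departure rates. The extreme value is attained strictly at `b = j` and
only there. -/
theorem SamplingMix.ae_eventually_frequencyAttack_eq {R Ω : Type*} [Fintype R]
    [MeasurableSpace Ω] {μ : Measure Ω} [IsProbabilityMeasure μ] (X : SamplingMix n k p R μ)
    (hk : 2 ≤ k) (hkn : k ≤ n) (hp0 : 0 ≤ p) (hp1 : p ≤ 1) (hkp : k = n → p = 1)
    (hp : p ≠ 1 / (n : ℝ)) (a : Fin n) :
    ∀ᵐ ω ∂μ, ∀ᶠ T in atTop, frequencyAttack n p R a ((X.input ω).record T) = X.recv a := by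
  have hn : 2 ≤ n := hk.trans hkn
  filter_upwards [X.ae_tendsto_departures_div_arrivals hk hkn hp0 hp1 hkp, X.ae_dest_mem]
    with ω h1 h2
  -- The comparison of the frequencies is eventually that of their limits.
  have hcmp : ∀ j, ∀ r ∈ X.recv j, ∀ b c, departureRate n p b j < departureRate n p c j →
      ∀ᶠ T in atTop, departureFrequency ((X.input ω).record T) b r
        < departureFrequency ((X.input ω).record T) c r := fun j r hr b c hbc =>
    (h1 b j r hr).eventually_lt (h1 c j r hr)
      (mul_lt_mul_of_pos_left hbc (X.toReal_choice_pos hr))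
  have hmem : ∀ r, ∀ᶠ T in atTop,
      (r ∈ frequencyAttack n p R a ((X.input ω).record T) ↔ r ∈ X.recv a) := by
    intro r
    obtain ⟨b, hb⟩ := exists_ne_of_two_le hn a
    by_cases hr : ∃ j, r ∈ X.recv j
    · obtain ⟨j, hr⟩ := hr
      by_cases hj : j = a
      · subst hj
        simp only [hr, iff_true]
        by_cases hlt : 1 / (n : ℝ) < p
        · simp only [mem_frequencyAttack_of_lt hlt]
          refine eventually_all.2 fun b => ?_
          by_cases hb : b = j
          · simp [hb]
          filter_upwards [hcmp j r hr b j (by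
            rw [departureRate, departureRate, if_pos rfl, if_neg (Ne.symm hb)]
            exact (lt_div_sub_one_iff hn).2 hlt)] with T hT _ using hT
        · simp only [mem_frequencyAttack_of_not_lt hlt]
          refine eventually_all.2 fun b => ?_
          by_cases hb : b = j
          · simp [hb]
          filter_upwards [hcmp j r hr j b (by
            rw [departureRate, departureRate, if_pos rfl, if_neg (Ne.symm hb)]
            exact (div_sub_one_lt_iff hn).2 (lt_of_le_of_ne (not_lt.1 hlt) hp))] with T hT _ using hT
      · have hra : r ∉ X.recv a :=
          Finset.disjoint_left.1 (X.recv_disjoint j a hj) hr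
        simp only [hra, iff_false]
        by_cases hlt : 1 / (n : ℝ) < p
        · filter_upwards [hcmp j r hr a j (by
            rw [departureRate, departureRate, if_pos rfl, if_neg hj]
            exact (lt_div_sub_one_iff hn).2 hlt)] with T hT h
          exact lt_asymm hT ((mem_frequencyAttack_of_lt hlt).1 h j hj)
        · filter_upwards [hcmp j r hr j a (by
            rw [departureRate, departureRate, if_pos rfl, if_neg hj]
            exact (div_sub_one_lt_iff hn).2 (lt_of_le_of_ne (not_lt.1 hlt) hp))] with T hT h
          exact lt_asymm hT ((mem_frequencyAttack_of_not_lt hlt).1 h j hj)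
    -- A member of the population who is nobody's receiver has frequency zero for every sender, and
    -- the strict comparison with some `b ≠ a` fails. Here a second sender is needed.
    · push Not at hr
      have h0 : ∀ T c, departureFrequency ((X.input ω).record T) c r = 0 := fun T c => by
        rw [departureFrequency, X.departures_eq_zero h2 hr, Nat.cast_zero, zero_div]
      refine Eventually.of_forall fun T => ?_
      simp only [hr a, iff_false]
      by_cases hlt : 1 / (n : ℝ) < p
      · rw [mem_frequencyAttack_of_lt hlt]
        intro h
        simpa [h0] using h b hb
      · rw [mem_frequencyAttack_of_not_lt hlt]
        intro h
        simpa [h0] using h b hb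
  -- The population is finite, so one time serves all `r`.
  filter_upwards [eventually_all.2 hmem] with T hT
  ext r
  exact hT r

/-- With a single receiver the address probability is one, so limits for different receivers are
comparable. Both counts are divided by the same number of arrivals from `a`, hence the comparison
passes to the counts. -/
theorem SamplingMix.ae_eventually_departures_lt {R Ω : Type*} [Fintype R]
    [MeasurableSpace Ω] {μ : Measure Ω} [IsProbabilityMeasure μ] (X : SamplingMix n k p R μ)
    (hk : 2 ≤ k) (hkn : k ≤ n) (hp0 : 0 ≤ p) (hp1 : p ≤ 1) (hkp : k = n → p = 1) (a : Fin n)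
    (hR : ∀ i, (X.recv i).card = 1) :
    ∀ᵐ ω ∂μ, ∀ᶠ T in atTop, ∀ r ∈ X.recv a, ∀ j, j ≠ a → ∀ r' ∈ X.recv j,
      (1 / (n : ℝ) < p →
        departures ((X.input ω).record T) a r' < departures ((X.input ω).record T) a r) ∧
      (p < 1 / (n : ℝ) →
        departures ((X.input ω).record T) a r < departures ((X.input ω).record T) a r') := by
  have hn : 2 ≤ n := hk.trans hkn
  have hone : ∀ j, ∀ r ∈ X.recv j, (X.choice j r).toReal = 1 := by
    intro j r hr
    obtain ⟨r', hr'⟩ := Finset.card_eq_one.1 (hR j)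
    rw [hr', Finset.mem_singleton] at hr
    subst hr
    have : X.choice j r = 1 := by
      rw [PMF.apply_eq_one_iff, X.support_choice, hr', Finset.coe_singleton]
    rw [this, ENNReal.toReal_one]
  filter_upwards [X.ae_tendsto_departures_div_arrivals hk hkn hp0 hp1 hkp] with ω h1
  have hcmp : ∀ j, ∀ r ∈ X.recv j, ∀ j', ∀ r' ∈ X.recv j',
      departureRate n p a j < departureRate n p a j' → ∀ᶠ T in atTop,
        departures ((X.input ω).record T) a r < departures ((X.input ω).record T) a r' := by
    intro j r hr j' r' hr' hlt
    have hj := h1 a j r hr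
    have hj' := h1 a j' r' hr'
    rw [hone j r hr, one_mul] at hj
    rw [hone j' r' hr', one_mul] at hj'
    filter_upwards [hj.eventually_lt hj' hlt] with T hT
    by_contra hle
    refine absurd hT (not_lt.2 ?_)
    gcongr
    exact_mod_cast not_lt.1 hle
  refine eventually_all.2 fun r => ?_
  by_cases hr : r ∈ X.recv a
  swap
  · exact Eventually.of_forall fun T h => absurd h hr
  simp only [hr, true_imp_iff]
  refine eventually_all.2 fun j => ?_
  by_cases hj : j = a
  · exact Eventually.of_forall fun T h => absurd hj h
  simp only [ne_eq, hj, not_false_eq_true, true_imp_iff]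
  refine eventually_all.2 fun r' => ?_
  by_cases hr' : r' ∈ X.recv j
  swap
  · exact Eventually.of_forall fun T h => absurd h hr'
  simp only [hr', true_imp_iff]
  refine Eventually.and ?_ ?_
  · by_cases hlt : 1 / (n : ℝ) < p
    · filter_upwards [hcmp j r' hr' a r hr (by
        rw [departureRate, departureRate, if_pos rfl, if_neg hj]
        exact (lt_div_sub_one_iff hn).2 hlt)] with T hT _ using hT
    · exact Eventually.of_forall fun T h => absurd h hlt
  · by_cases hlt : p < 1 / (n : ℝ)
    · filter_upwards [hcmp a r hr j r' hr' (by
        rw [departureRate, departureRate, if_pos rfl, if_neg hj]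
        exact (div_sub_one_lt_iff hn).2 hlt)] with T hT _ using hT
    · exact Eventually.of_forall fun T h => absurd h hlt

end Attack

theorem theorem5 (n k : ℕ) [NeZero n] (hk : 2 ≤ k) (hkn : k ≤ n) (p : ℝ) (hp0 : 0 ≤ p)
    (hp1 : p ≤ 1) (hkp : k = n → p = 1) (hp : p ≠ 1 / (n : ℝ)) (R : Type*) [Fintype R] :
    -- All receivers of any target are identified, almost surely, from some time on.
    (∃ attack : StatelessAttack n R,
      ∀ (Ω : Type*) [MeasurableSpace Ω] (μ : Measure Ω) [IsProbabilityMeasure μ]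
        (X : SamplingMix n k p R μ) (a : Fin n),
        ∀ᵐ ω ∂μ, ∀ᶠ T in atTop, attack a ((X.input ω).record T) = X.recv a) ∧
    -- The departure frequencies per arrival from the target.
    p ≠ (1 - p) / ((n : ℝ) - 1) ∧
    ∀ (Ω : Type*) [MeasurableSpace Ω] (μ : Measure Ω) [IsProbabilityMeasure μ]
      (X : SamplingMix n k p R μ) (a : Fin n),
      (∀ᵐ ω ∂μ, ∀ j, ∀ r ∈ X.recv j,
        Tendsto (fun T => (departures ((X.input ω).record T) a r : ℝ) /
            (arrivals ((X.input ω).record T) a : ℝ)) atTop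
          (𝓝 ((X.choice j r).toReal * if j = a then p else (1 - p) / ((n : ℝ) - 1)))) ∧
      -- In steady state these are the probabilities of departures from the queues.
      (X.InSteadyState → ∀ (t : ℕ) (j : Fin n),
        (cond μ {ω | (X.input ω).sender t = a}).real {ω | ∃ r, (X.input ω).Forwards t j r} =
          if j = a then p else (1 - p) / ((n : ℝ) - 1)) ∧
      -- With one receiver per sender, the receiver of the target stands out by its count.
      ((∀ i, (X.recv i).card = 1) →
        ∀ᵐ ω ∂μ, ∀ᶠ T in atTop, ∀ r ∈ X.recv a, ∀ j, j ≠ a → ∀ r' ∈ X.recv j,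
          (1 / (n : ℝ) < p →
            departures ((X.input ω).record T) a r' < departures ((X.input ω).record T) a r) ∧
          (p < 1 / (n : ℝ) →
            departures ((X.input ω).record T) a r < departures ((X.input ω).record T) a r')) := by
  have hn : 2 ≤ n := hk.trans hkn
  refine ⟨⟨frequencyAttack n p R, fun Ω _ μ _ X a =>
    X.ae_eventually_frequencyAttack_eq hk hkn hp0 hp1 hkp hp a⟩, ?_, fun Ω _ μ _ X a =>
    ⟨?_, fun hX t j => X.cond_exists_forwards hk hkn hp0 hp1 hkp hX t a j,
      X.ae_eventually_departures_lt hk hkn hp0 hp1 hkp a⟩⟩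
  · rcases lt_or_gt_of_ne hp with h | h
    · exact ((div_sub_one_lt_iff hn).2 h).ne
    · exact ((lt_div_sub_one_iff hn).2 h).ne'
  · filter_upwards [X.ae_tendsto_departures_div_arrivals hk hkn hp0 hp1 hkp] with ω h
    exact h a
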